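/- Let $p\ge 1$ and $n\ge p+1$ be integers. Let $\mathbb T_p$ be the set of upper triangular real $p\times p$ matrices with positive diagonal entries, and let $\pi_H$ be the measure on $\mathbb R^p\times\mathbb T_p$ given by $$d\pi_H(\mu,\Lambda)=\prod_{j=1}^p\Lambda_{jj}^{\,j-p-1}\,d\mu\,d\Lambda .$$ Let $F^\star$ be a random probability measure on $\mathbb R^p$ that is almost surely absolutely continuous with respect to Lebesgue measure. For $\mu\in\mathbb R^p$ and a nonsingular matrix $\Lambda$ let $F^\star_{\mu,\Lambda}$ be the image of $F^\star$ under $z\mapsto\mu+\Lambda z$, and assume rotation invariance: for every orthogonal matrix $A$, $F^\star_{0,A'}$ and $F^\star$ have the same law. For $(\mu,\Lambda)\in\mathbb R^p\times\mathbb T_p$ let $\Pi_{\mu,\Lambda}$ be the law of $F^\star_{\mu,\Lambda}$ (so $\{\Pi_{\mu,\Lambda}\}$ is an absolutely continuous, rotation-invariant location-scale family), and put $\Pi=\int\Pi_{\mu,\Lambda}\,d\pi_H(\mu,\Lambda)$ and $$m_{\Pi,n}(x_1,\dots,x_n)=\int\prod_{i=1}^n f_F(x_i)\,d\Pi(F)\in[0,\infty],\qquad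 x_1,\dots,x_n\in\mathbb R^p,$$ where $f_F$ is the Lebesgue density of $F$, taken in the version $f_F(x)=\limsup_{k\to\infty}F(\bar B(x,1/k))/|\bar B(x,1/k)|$. Then: 1. $m_{\Pi,n}$ is a Lebesgue density of the predictive distribution $M_{\Pi,n}=\int F^{\times n}\,d\Pi(F)$, where $F^{\times n}$ is the $n$-fold product measure. For every $a\in\mathbb R^p$, every nonsingular $p\times p$ matrix $S$ and all $x_1,\dots,x_n\in\mathbb R^p$, $$m_{\Pi,n}(a+Sx_1,\dots,a+Sx_n)=|\det S|^{-(n-1)}\,m_{\Pi,n}(x_1,\dots,x_n).$$ 2. Consequently the Bayes factor $B(x_1,\dots,x_n)=m_{\Pi^0,n}(x_1,\dots,x_n)/m_{\Pi,n}(x_1,\dots,x_n)$ of the normal model against this model, where $\Pi^0=\int\delta_{N(\mu,\Lambda\Lambda')}\,d\pi_H(\mu,\Lambda)$, satisfies $B(a+Sx_1,\dots,a+Sx_n)=B(x_1,\dots,x_n)$ for all such $a$, $S$, $x_1,\dots,x_n$ (the quotient is taken in $[0,\infty]$, with $y/0=\infty$ for $y>0$, $y/\infty=0$, and $0/0=\infty/\infty=0$).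 3. In particular, this invariance holds for the Dirichlet process mixture alternative: let $\alpha>0$ and $\omega_1,\omega_2>(p-1)/2$, let $\Psi$ be the law of $(U,V)$ where $V$ has the multivariate beta distribution, with density proportional to $(\det V)^{\omega_1-(p+1)/2}\{\det(I_p-V)\}^{\omega_2-(p+1)/2}$ on the symmetric $p\times p$ matrices with all eigenvalues in $(0,1)$, and $U\mid V\sim N(0,I_p-V)$; and let $\Pi_{\mu,\Lambda}$ be the law of $\int N(\mu+\Lambda u,\Lambda V\Lambda')\,d\bar\Psi(u,V)$, where $\bar\Psi$ is a Dirichlet process with precision $\alpha$ and base measure $\Psi$. -/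

import Mathlib

open MeasureTheory ProbabilityTheory Filter
open scoped ENNReal

namespace AffineBayes

noncomputable section

/-- The Borel sigma-algebra on square matrices (the product sigma-algebra of the entries). -/
instance instMeasurableSpaceMatrix (p : ℕ) : MeasurableSpace (Matrix (Fin p) (Fin p) ℝ) :=
  inferInstanceAs (MeasurableSpace (Fin p → Fin p → ℝ))

/-- `ℝ^p`. -/
abbrev Vec (p : ℕ) : Type := EuclideanSpace ℝ (Fin p)

/-- `p × p` real matrices. -/
abbrev Mat (p : ℕ) : Type := Matrix (Fin p) (Fin p) ℝ

/-- The affine map `x ↦ a + S x` of `ℝ^p`. -/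
def affineMap {p : ℕ} (a : Vec p) (S : Mat p) (x : Vec p) : Vec p :=
  a + Matrix.toEuclideanCLM (𝕜 := ℝ) S x

/-! ### Triangular and symmetric matrices, and the Haar prior -/

/-- Positions on or above the diagonal: the free coordinates of an upper triangular matrix, and of
a symmetric matrix. -/
abbrev UpperIndex (p : ℕ) : Type := {q : Fin p × Fin p // q.1 ≤ q.2}

/-- The upper triangular matrix with the given entries on and above the diagonal. -/
def upperMatrix {p : ℕ} (t : UpperIndex p → ℝ) : Mat p :=
  Matrix.of fun i j => if h : i ≤ j then t ⟨(i, j), h⟩ else 0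

/-- The symmetric matrix with the given entries on and above the diagonal. -/
def symmMatrix {p : ℕ} (t : UpperIndex p → ℝ) : Mat p :=
  Matrix.of fun i j => t ⟨(min i j, max i j), min_le_max⟩

/-- `𝕋_p`: upper triangular matrices with positive diagonal entries. -/
def posTriangular (p : ℕ) : Set (Mat p) :=
  {L | (∀ i j, j < i → L i j = 0) ∧ ∀ j, 0 < L j j}

/-- The measure `dΛ = ∏_{i ≤ j} dΛ_{ij}` on upper triangular matrices. -/
def triangularLebesgue (p : ℕ) : Measure (Mat p) :=
  (volume : Measure (UpperIndex p → ℝ)).map upperMatrix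

/-- The measure `dV = ∏_{i ≤ j} dV_{ij}` on symmetric matrices. -/
def symmetricLebesgue (p : ℕ) : Measure (Mat p) :=
  (volume : Measure (UpperIndex p → ℝ)).map symmMatrix

/-- The prior `dπ_H(μ, Λ) = ∏_j Λ_{jj}^{j-p-1} dμ dΛ` on `ℝ^p × 𝕋_p` (with `j` running through
`1, …, p`; the element `j : Fin p` stands for the index `j + 1`). -/
def haarPrior (p : ℕ) : Measure (Vec p × Mat p) :=
  (volume : Measure (Vec p)).prod
    (((triangularLebesgue p).restrict (posTriangular p)).withDensity fun L =>
      ENNReal.ofReal (∏ j : Fin p, L j j ^ (((j : ℕ) : ℤ) + 1 - (p : ℤ) - 1)))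

/-! ### Random probability measures and location-scale families -/

/-- `Q` is the law of a random probability measure on `X`. -/
structure IsRandomProbabilityLaw {X : Type*} [MeasurableSpace X] (Q : Measure (Measure X)) :
    Prop where
  isProbabilityMeasure : IsProbabilityMeasure Q
  ae_isProbabilityMeasure : ∀ᵐ F ∂Q, IsProbabilityMeasure F

/-- The measure `F_{μ,Λ}` with `dF_{μ,Λ}(x) = |det Λ|⁻¹ dF(Λ⁻¹(x - μ))`, that is, the image of `F`
under `z ↦ μ + Λ z`. -/
def locationScale {p : ℕ} (μ : Vec p) (L : Mat p) (F : Measure (Vec p)) : Measure (Vec p) :=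
  F.map (affineMap μ L)

/-- The family of laws `Fam μ Λ`, `μ ∈ ℝ^p`, `Λ ∈ 𝕋_p`, is the location-scale family characterized
by a random probability measure `F⋆` of law `Q`: `Fam μ Λ` is the law of `F⋆_{μ,Λ}`. -/
structure IsLocationScaleFamily {p : ℕ} (Fam : Vec p → Mat p → Measure (Measure (Vec p)))
    (Q : Measure (Measure (Vec p))) : Prop where
  law : IsRandomProbabilityLaw Q
  eq_map : ∀ μ : Vec p, ∀ L ∈ posTriangular p, Fam μ L = Q.map (locationScale μ L)

/-- The random measure of law `Q` is almost surely absolutely continuous with respect to Lebesgue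
measure. -/
def IsAbsolutelyContinuousLaw {p : ℕ} (Q : Measure (Measure (Vec p))) : Prop :=
  ∀ᵐ F ∂Q, F ≪ (volume : Measure (Vec p))

/-- `F⋆_{0,A'}` and `F⋆` have the same law for every orthogonal matrix `A`. -/
def IsRotationInvariantLaw {p : ℕ} (Q : Measure (Measure (Vec p))) : Prop :=
  ∀ A ∈ Matrix.orthogonalGroup (Fin p) ℝ, Q.map (locationScale 0 A.transpose) = Q

/-! ### Mixtures, predictive distributions, marginal likelihoods -/

/-- The mixture `Π = ∫ Π_{μ,Λ} dπ_H(μ, Λ)`. -/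
def haarMixture {p : ℕ} (Fam : Vec p → Mat p → Measure (Measure (Vec p))) :
    Measure (Measure (Vec p)) :=
  (haarPrior p).bind fun q => Fam q.1 q.2

/-- The predictive distribution `M_{Π,n} = ∫ F^{×n} dΠ(F)` of a sample of size `n`. -/
def predictive {p : ℕ} (Pi : Measure (Measure (Vec p))) (n : ℕ) : Measure (Fin n → Vec p) :=
  Pi.bind fun F => Measure.pi fun _ : Fin n => F

/-- The Lebesgue density of `F`, in the everywhere defined version given by differentiation along
balls of radius `1 / (k + 1)`. For an absolutely continuous probability measure it agrees almost
everywhere with the Radon-Nikodym derivative. -/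
def density {p : ℕ} (F : Measure (Vec p)) (x : Vec p) : ℝ≥0∞ :=
  limsup (fun k : ℕ => F (Metric.closedBall x (1 / ((k : ℝ) + 1))) /
    volume (Metric.closedBall x (1 / ((k : ℝ) + 1)))) atTop

/-- The marginal likelihood `m_{Π,n}(x_1, …, x_n) = ∫ ∏_i f_F(x_i) dΠ(F)`, where `f_F` is the
Lebesgue density of `F`. -/
def marginalLikelihood {p : ℕ} (Pi : Measure (Measure (Vec p))) (n : ℕ) (x : Fin n → Vec p) :
    ℝ≥0∞ :=
  ∫⁻ F, ∏ i, density F (x i) ∂Pi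

/-- The Bayes factor: marginal likelihood of the data under the null family over that under the
alternative family, both mixed over `π_H`. -/
def bayesFactor {p : ℕ} (Null Alt : Vec p → Mat p → Measure (Measure (Vec p))) (n : ℕ)
    (x : Fin n → Vec p) : ℝ≥0∞ :=
  marginalLikelihood (haarMixture Null) n x / marginalLikelihood (haarMixture Alt) n x

/-! ### The normal null model -/

/-- The normal model: `F = N(μ, ΛΛ')` with probability one. -/
def normalFamily (p : ℕ) (μ : Vec p) (L : Mat p) : Measure (Measure (Vec p)) :=
  Measure.dirac (multivariateGaussian μ (L * L.transpose))

/-! ### The Dirichlet process mixture alternative -/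

/-- The space of symmetric positive definite matrices with all eigenvalues in `(0, 1)`, i.e. such
that both `V` and `I - V` are positive definite. -/
def posDefUnit (p : ℕ) : Set (Mat p) :=
  {V | V.PosDef ∧ (1 - V).PosDef}

/-- The density of the multivariate beta distribution up to its normalizing constant. -/
def betaWeight (p : ℕ) (ω₁ ω₂ : ℝ) (V : Mat p) : ℝ≥0∞ :=
  ENNReal.ofReal
    (V.det ^ (ω₁ - ((p : ℝ) + 1) / 2) * (1 - V).det ^ (ω₂ - ((p : ℝ) + 1) / 2))

/-- The unnormalized multivariate beta measure. -/
def betaUnnormalized (p : ℕ) (ω₁ ω₂ : ℝ) : Measure (Mat p) :=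
  ((symmetricLebesgue p).restrict (posDefUnit p)).withDensity (betaWeight p ω₁ ω₂)

/-- The multivariate beta distribution `Be(ω₁, ω₂)`. -/
def multivariateBeta (p : ℕ) (ω₁ ω₂ : ℝ) : Measure (Mat p) :=
  (betaUnnormalized p ω₁ ω₂ Set.univ)⁻¹ • betaUnnormalized p ω₁ ω₂

/-- The base measure `Ψ`: the law of `(U, V)` with `V ∼ Be(ω₁, ω₂)` and `U ∣ V ∼ N(0, I - V)`. -/
def baseMeasure (p : ℕ) (ω₁ ω₂ : ℝ) : Measure (Vec p × Mat p) :=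
  (multivariateBeta p ω₁ ω₂).bind fun V =>
    (multivariateGaussian (0 : Vec p) (1 - V)).map fun u => (u, V)

/-- The Gamma distribution with shape `a ≥ 0` and rate `1`, the point mass at `0` if `a = 0`. -/
def gammaLaw (a : ℝ) : Measure ℝ :=
  if 0 < a then gammaMeasure a 1 else Measure.dirac 0

/-- The Dirichlet distribution with parameters `a i ≥ 0`, not all zero: the law of
`(G_i / ∑_j G_j)_i` for independent `G_i ∼ Gamma(a i, 1)`. -/
def dirichletLaw {k : ℕ} (a : Fin k → ℝ) : Measure (Fin k → ℝ) :=
  (Measure.pi fun i => gammaLaw (a i)).map fun g i => g i / ∑ j, g j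

/-- `D` is the law `DP(α, Ψ)` of a Dirichlet process: for every finite measurable partition
`B_1, …, B_k` the vector `(Ψ̄(B_1), …, Ψ̄(B_k))` is Dirichlet with parameters `α Ψ(B_i)`. -/
structure IsDirichletProcess {X : Type*} [MeasurableSpace X] (D : Measure (Measure X)) (α : ℝ)
    (Ψ : Measure X) : Prop where
  law : IsRandomProbabilityLaw D
  partition : ∀ (k : ℕ) (B : Fin k → Set X), (∀ i, MeasurableSet (B i)) →
    Pairwise (Function.onFun Disjoint B) → (⋃ i, B i) = Set.univ →
    D.map (fun ψ i => (ψ (B i)).toReal) = dirichletLaw fun i => α * (Ψ (B i)).toReal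

/-- The normal mixture `∫ N(μ + Λ u, Λ V Λ') dψ(u, V)`. -/
def normalMixture {p : ℕ} (μ : Vec p) (L : Mat p) (ψ : Measure (Vec p × Mat p)) :
    Measure (Vec p) :=
  ψ.bind fun q => multivariateGaussian (affineMap μ L q.1) (L * q.2 * L.transpose)

/-- The Dirichlet process mixture family: the law of `∫ N(μ + Λ u, Λ V Λ') dΨ̄(u, V)` for `Ψ̄` of
law `D`. -/
def dpmFamily {p : ℕ} (D : Measure (Measure (Vec p × Mat p))) (μ : Vec p) (L : Mat p) :
    Measure (Measure (Vec p)) :=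
  D.map (normalMixture μ L)

end

end AffineBayes

open AffineBayes

namespace AffineBayes

/-! ### Measurability of matrix operations -/

/-! By Tonelli the marginal likelihood is an integral over `haarTriangular` of `scaleLikelihood Q L
x`, in which the location has already been integrated out against Lebesgue measure
(`marginalLikelihood_haarMixture`). Integrating over the location absorbs the shift `a`. It also
turns the almost everywhere transformation rule of densities under linear maps into an identity at
every data point: replacing `(L, x)` by `(S L, S x)` produces `n` factors `|det S|⁻¹` from the
densities and one factor `|det S|` from the location variable (`scaleLikelihood_mul_affineMap`).

It remains to replace `L` by `S⁻¹ L` under the integral, although `S⁻¹ L` need not be triangular.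
Rotation invariance makes `scaleLikelihood` a function on the quotient of the general linear group
by the orthogonal group (`scaleLikelihood_mul_orthogonal`). Every nonsingular matrix is a product of
an element of `𝕋_p` and an orthogonal one, so `𝕋_p` parametrizes this quotient, and its left Haar
measure is the invariant measure there
(`lintegral_haarTriangular_mul_left_of_orthogonal_invariant`). The Jacobian of the factorization is
never computed: the two Haar measures are compared by evaluating one double integral in both orders.

The factor obtained is positive, finite and independent of the family, so it cancels in the Bayes
factor; the normal model is the case of a deterministic standard Gaussian.

For the Dirichlet process mixture two properties are checked. Rotation invariance: `(u, V) ↦ (A u, A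
V A')` preserves the base measure, and a Dirichlet process is determined by its precision and base
measure, so its law is preserved as well (`IsDirichletProcess.map_map_eq`). Absolute continuity: the
process almost surely puts no mass on singular `V` (`IsDirichletProcess.ae_measure_eq_zero`), so the
mixture has only nondegenerate Gaussian components. -/

instance instBorelSpaceMatrix (p : ℕ) : BorelSpace (Mat p) :=
  inferInstanceAs (BorelSpace (Fin p → Fin p → ℝ))

instance instStandardBorelSpaceMatrix (p : ℕ) : StandardBorelSpace (Mat p) :=
  inferInstanceAs (StandardBorelSpace (Fin p → Fin p → ℝ))

instance instSecondCountableTopologyMatrix (p : ℕ) : SecondCountableTopology (Mat p) :=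
  inferInstanceAs (SecondCountableTopology (Fin p → Fin p → ℝ))

lemma measurable_matrix_det {p : ℕ} : Measurable fun X : Mat p => X.det :=
  (Continuous.matrix_det continuous_id).measurable

lemma measurable_matrix_mul {p : ℕ} : Measurable fun q : Mat p × Mat p => q.1 * q.2 :=
  (Continuous.matrix_mul continuous_fst continuous_snd).measurable

lemma measurable_matrix_inv {p : ℕ} : Measurable fun X : Mat p => X⁻¹ := by
  have h : (fun X : Mat p => X⁻¹) = fun X : Mat p => (X.det)⁻¹ • X.adjugate := by
    ext1 X
    rw [Matrix.inv_def, Ring.inverse_eq_inv']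
  rw [h]
  have hadj : Measurable fun X : Mat p => X.adjugate :=
    (Continuous.matrix_adjugate continuous_id).measurable
  refine measurable_pi_iff.2 fun i => measurable_pi_iff.2 fun j => ?_
  exact (measurable_matrix_det.inv).mul
    ((measurable_pi_apply j).comp ((measurable_pi_apply i).comp hadj))

lemma affineMap_apply {p : ℕ} (a : Vec p) (S : Mat p) (x : Vec p) (i : Fin p) :
    affineMap a S x i = a i + ∑ j, S i j * x j := by
  simp [affineMap, Matrix.ofLp_toEuclideanCLM, Matrix.mulVec, dotProduct]

lemma continuous_affineMap_uncurried {p : ℕ} :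
    Continuous fun q : (Vec p × Mat p) × Vec p => affineMap q.1.1 q.1.2 q.2 := by
  refine (PiLp.continuous_toLp 2 fun _ : Fin p => ℝ).comp
    (f := fun q : (Vec p × Mat p) × Vec p => (affineMap q.1.1 q.1.2 q.2).ofLp) ?_
  refine continuous_pi fun i => ?_
  simp only [affineMap_apply]
  refine Continuous.add (by fun_prop) (continuous_finsetSum _ fun j _ => Continuous.mul ?_ ?_)
  · exact (continuous_apply_apply i j).comp (continuous_snd.comp continuous_fst)
  · fun_prop

lemma measurable_affineMap_uncurried {p : ℕ} :
    Measurable fun q : (Vec p × Mat p) × Vec p => affineMap q.1.1 q.1.2 q.2 :=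
  continuous_affineMap_uncurried.measurable

lemma measurable_affineMap {p : ℕ} (a : Vec p) (S : Mat p) : Measurable (affineMap a S) :=
  measurable_affineMap_uncurried.comp
    ((measurable_const (a := (a, S))).prodMk measurable_id)

lemma affineMap_comp {p : ℕ} (a b : Vec p) (S T : Mat p) (x : Vec p) :
    affineMap a S (affineMap b T x) = affineMap (affineMap a S b) (S * T) x := by
  simp [affineMap, add_assoc]

@[simp]
lemma affineMap_zero_one {p : ℕ} (x : Vec p) : affineMap 0 1 x = x := by
  simp [affineMap]

lemma affineMap_inv_affineMap {p : ℕ} {S : Mat p} (hS : S.det ≠ 0) (x : Vec p) :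
    affineMap 0 S⁻¹ (affineMap 0 S x) = x := by
  rw [affineMap_comp, Matrix.nonsing_inv_mul S hS.isUnit]
  simp [affineMap]

lemma isClosed_posSemidef (p : ℕ) : IsClosed {V : Mat p | V.PosSemidef} := by
  have h : {V : Mat p | V.PosSemidef} = {V | V.transpose = V} ∩
      ⋂ x : Fin p → ℝ, {V | 0 ≤ x ⬝ᵥ (V.mulVec x)} := by
    ext V
    simp [Matrix.posSemidef_iff_dotProduct_mulVec, Matrix.IsHermitian]
  rw [h]
  refine (isClosed_eq (Continuous.matrix_transpose continuous_id) continuous_id).inter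
    (isClosed_iInter fun x => isClosed_le continuous_const ?_)
  exact Continuous.dotProduct continuous_const
    (Continuous.matrix_mulVec continuous_id continuous_const)

lemma measurableSet_posSemidef (p : ℕ) : MeasurableSet {V : Mat p | V.PosSemidef} :=
  (isClosed_posSemidef p).measurableSet

lemma posDef_iff_posSemidef_det_ne_zero {p : ℕ} (V : Mat p) :
    V.PosDef ↔ V.PosSemidef ∧ V.det ≠ 0 := by
  refine ⟨fun h => ⟨h.posSemidef, h.det_pos.ne'⟩, fun h => ?_⟩
  exact (h.1.posDef_iff_isUnit).2 ((Matrix.isUnit_iff_isUnit_det V).2 h.2.isUnit)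

lemma measurableSet_posDef (p : ℕ) : MeasurableSet {V : Mat p | V.PosDef} := by
  simp only [posDef_iff_posSemidef_det_ne_zero]
  exact (measurableSet_posSemidef p).inter
    (measurable_matrix_det (measurableSet_singleton 0).compl)

section Sqrt

open scoped MatrixOrder

/-- Squaring is an injective Borel map on the standard Borel space of positive semidefinite
matrices, so it sends Borel sets to Borel sets, and there preimages under the root are images under
squaring. Elsewhere the root has the default value `0`. -/
lemma measurable_matrix_sqrt {p : ℕ} : Measurable fun V : Mat p => CFC.sqrt V := by
  classical
  let s : Set (Mat p) := {V | V.PosSemidef}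
  have hs : MeasurableSet s := measurableSet_posSemidef p
  have : StandardBorelSpace s := hs.standardBorel
  have hf : MeasurableEmbedding fun A : s => (A : Mat p) * A := by
    refine Measurable.measurableEmbedding
      (measurable_matrix_mul.comp (measurable_subtype_coe.prodMk measurable_subtype_coe)) ?_
    intro A B hAB
    have hA : (0 : Mat p) ≤ A := A.2.nonneg
    have hB : (0 : Mat p) ≤ B := B.2.nonneg
    have h := congrArg CFC.sqrt hAB
    simp only [CFC.sqrt_mul_self _ hA, CFC.sqrt_mul_self _ hB] at h
    exact Subtype.ext h
  have hneg : ∀ V : Mat p, V ∉ s → CFC.sqrt V = 0 := by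
    intro V hV
    rw [CFC.sqrt, cfcₙ_apply_of_not_predicate]
    change ¬ (V - 0).PosSemidef
    rwa [sub_zero]
  intro B hB
  have h : (fun V : Mat p => CFC.sqrt V) ⁻¹' B =
      (fun A : s => (A : Mat p) * A) '' (Subtype.val ⁻¹' B) ∪ (sᶜ ∩ {_V | (0 : Mat p) ∈ B}) := by
    ext V
    by_cases hV : V ∈ s
    · simp only [Set.mem_preimage, Set.mem_union, Set.mem_inter_iff, Set.mem_compl_iff, hV,
        not_true_eq_false, false_and, or_false, Set.mem_image]
      constructor
      · intro h
        exact ⟨⟨CFC.sqrt V, Matrix.nonneg_iff_posSemidef.1 (CFC.sqrt_nonneg V)⟩, h,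
          CFC.sqrt_mul_sqrt_self V hV.nonneg⟩
      · rintro ⟨A, hA, rfl⟩
        rwa [CFC.sqrt_mul_self _ A.2.nonneg]
    · have : ∀ A : s, (A : Mat p) * A ≠ V := by
        rintro A rfl
        refine hV ?_
        have h1 := Matrix.posSemidef_conjTranspose_mul_self (A : Mat p)
        rwa [A.2.1.eq] at h1
      simp [hV, hneg V hV, this]
  rw [h]
  exact (hf.measurableSet_image.2 (measurable_subtype_coe hB)).union
    (hs.compl.inter (MeasurableSet.const _))

end Sqrt

/-! ### Gaussian measures -/

lemma measurable_map_of_measurable_uncurried {Ω X Y : Type*} [MeasurableSpace Ω]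
    [MeasurableSpace X] [MeasurableSpace Y] (ν : Measure X) [SFinite ν] {f : Ω → X → Y}
    (hf : Measurable (Function.uncurry f)) : Measurable fun ω => ν.map (f ω) := by
  refine Measure.measurable_of_measurable_coe _ fun B hB => ?_
  have h : (fun ω => ν.map (f ω) B) = fun ω => ν (Prod.mk ω ⁻¹' (Function.uncurry f ⁻¹' B)) := by
    ext1 ω
    rw [Measure.map_apply (f := f ω) (hf.comp measurable_prodMk_left) hB]
    rfl
  rw [h]
  exact measurable_measure_prodMk_left (hf hB)

open scoped MatrixOrder in
-- The Gaussian measure is by definition the image of the standard one under `x ↦ μ + √V x`, so only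
-- the measurability of the square root matters. This is what makes Gaussian mixtures well-behaved
-- integrals of kernels.
lemma measurable_multivariateGaussian {p : ℕ} :
    Measurable fun q : Vec p × Mat p => multivariateGaussian q.1 q.2 := by
  refine measurable_map_of_measurable_uncurried (stdGaussian (Vec p))
    (f := fun (q : Vec p × Mat p) x => affineMap q.1 (CFC.sqrt q.2) x) ?_
  exact measurable_affineMap_uncurried.comp
    ((measurable_fst.fst.prodMk (measurable_matrix_sqrt.comp measurable_fst.snd)).prodMk
      measurable_snd)

lemma inner_toEuclideanCLM_transpose {p : ℕ} (L : Mat p) (x y : Vec p) :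
    inner ℝ (Matrix.toEuclideanCLM (𝕜 := ℝ) L x) y =
      inner ℝ x (Matrix.toEuclideanCLM (𝕜 := ℝ) L.transpose y) := by
  have h : Matrix.toEuclideanCLM (𝕜 := ℝ) L.transpose =
      ContinuousLinearMap.adjoint (Matrix.toEuclideanCLM (n := Fin p) (𝕜 := ℝ) L) := by
    rw [← ContinuousLinearMap.star_eq_adjoint, ← map_star]
    rfl
  rw [h, ContinuousLinearMap.adjoint_inner_right]

lemma posSemidef_conj_iff {p : ℕ} {L V : Mat p} (hL : L.det ≠ 0) :
    (L * V * L.transpose).PosSemidef ↔ V.PosSemidef := by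
  have hu : IsUnit L := (Matrix.isUnit_iff_isUnit_det L).2 hL.isUnit
  constructor
  · intro h
    have h1 := h.mul_mul_conjTranspose_same L⁻¹
    have h2 : L⁻¹ * (L * V * L.transpose) * L⁻¹.conjTranspose = V := by
      rw [Matrix.conjTranspose_eq_transpose_of_trivial, Matrix.mul_assoc L⁻¹,
        Matrix.mul_assoc (L * V), ← Matrix.transpose_mul, Matrix.nonsing_inv_mul L hL.isUnit,
        Matrix.transpose_one, Matrix.mul_one, ← Matrix.mul_assoc,
        Matrix.nonsing_inv_mul L hL.isUnit, Matrix.one_mul]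
    rwa [h2] at h1
  · intro h
    exact h.mul_mul_conjTranspose_same L

/-- Characteristic functions agree if `V` is positive semidefinite. Otherwise neither covariance is,
as `L` is invertible, and both sides are point masses by convention. Having no condition on `V`
allows use under an integral over all `(u, V)`. -/
lemma multivariateGaussian_map_affineMap {p : ℕ} (a : Vec p) {L : Mat p} (hL : L.det ≠ 0)
    (u : Vec p) (V : Mat p) :
    (multivariateGaussian u V).map (affineMap a L) =
      multivariateGaussian (affineMap a L u) (L * V * L.transpose) := by
  by_cases hV : V.PosSemidef
  · have : IsProbabilityMeasure ((multivariateGaussian u V).map (affineMap a L)) :=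
      Measure.isProbabilityMeasure_map (measurable_affineMap a L).aemeasurable
    refine Measure.ext_of_charFun (funext fun t => ?_)
    rw [charFun_multivariateGaussian ((posSemidef_conj_iff hL).2 hV)]
    have h1 : charFun ((multivariateGaussian u V).map (affineMap a L)) t =
        Complex.exp (inner ℝ a t * Complex.I) *
          charFun (multivariateGaussian u V) (Matrix.toEuclideanCLM (𝕜 := ℝ) L.transpose t) := by
      rw [charFun_apply, charFun_apply,
        integral_map (measurable_affineMap a L).aemeasurable (by fun_prop),
        ← integral_const_mul]
      congr 1
      ext1 x
      rw [← Complex.exp_add, affineMap, inner_add_left, inner_toEuclideanCLM_transpose]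
      push_cast
      ring_nf
    rw [h1, charFun_multivariateGaussian hV, ← Complex.exp_add]
    congr 1
    have h2 : inner ℝ (Matrix.toEuclideanCLM (𝕜 := ℝ) L.transpose t) u =
        inner ℝ t (Matrix.toEuclideanCLM (𝕜 := ℝ) L u) := by
      rw [inner_toEuclideanCLM_transpose, Matrix.transpose_transpose]
    have h3 : (Matrix.toEuclideanCLM (𝕜 := ℝ) L.transpose t).ofLp ⬝ᵥ
        V.mulVec (Matrix.toEuclideanCLM (𝕜 := ℝ) L.transpose t).ofLp =
        t.ofLp ⬝ᵥ (L * V * L.transpose).mulVec t.ofLp := by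
      simp [← Matrix.mulVec_mulVec, Matrix.dotProduct_mulVec, 
        Matrix.mulVec_transpose, Matrix.vecMul_vecMul]
    rw [h2, h3, affineMap, inner_add_right, real_inner_comm]
    push_cast
    ring
  · rw [multivariateGaussian_of_not_posSemidef _ hV,
      multivariateGaussian_of_not_posSemidef _ (fun h => hV ((posSemidef_conj_iff hL).1 h)),
      Measure.map_dirac' (measurable_affineMap a L)]

/-! ### Densities of product measures and of Gaussian measures -/

lemma lintegral_pi_fin_prod {n : ℕ} {E : Type*} [MeasurableSpace E]
    (ν : Fin n → Measure E) [∀ i, SigmaFinite (ν i)] (f : Fin n → E → ℝ≥0∞)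
    (hf : ∀ i, Measurable (f i)) :
    ∫⁻ x, ∏ i, f i (x i) ∂(Measure.pi ν) = ∏ i, ∫⁻ x, f i x ∂(ν i) := by
  induction n with
  | zero => simp
  | succ n ih =>
    calc
      _ = ∫⁻ x : E × (Fin n → E), f 0 x.1 * ∏ i : Fin n, f i.succ (x.2 i)
            ∂((ν 0).prod (Measure.pi fun i => ν i.succ)) := by
        rw [← ((measurePreserving_piFinSuccAbove ν 0).symm).lintegral_comp_emb
          (MeasurableEquiv.measurableEmbedding _)]
        simp_rw [MeasurableEquiv.piFinSuccAbove_symm_apply, Fin.insertNthEquiv,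
          Fin.prod_univ_succ, Fin.insertNth_zero, Equiv.coe_fn_mk, Fin.cons_succ,
          Fin.zero_succAbove, Fin.cons_zero, cast_eq]
      _ = (∫⁻ x, f 0 x ∂ν 0) * ∏ i : Fin n, ∫⁻ x, f i.succ x ∂ν i.succ := by
        rw [← ih _ _ fun i => hf _]
        exact lintegral_prod_mul (hf 0).aemeasurable
          (Finset.measurable_prod _ fun i _ => (hf _).comp (measurable_pi_apply i)).aemeasurable
      _ = ∏ i, ∫⁻ x, f i x ∂ν i := by rw [Fin.prod_univ_succ]

lemma pi_withDensity {n : ℕ} {E : Type*} [MeasurableSpace E]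
    (ν : Fin n → Measure E) [∀ i, SigmaFinite (ν i)] (f : Fin n → E → ℝ≥0∞)
    (hf : ∀ i, Measurable (f i)) [∀ i, SigmaFinite ((ν i).withDensity (f i))] :
    Measure.pi (fun i => (ν i).withDensity (f i)) =
      (Measure.pi ν).withDensity fun x => ∏ i, f i (x i) := by
  refine Measure.pi_eq fun s hs => ?_
  rw [withDensity_apply _ (MeasurableSet.univ_pi hs), Measure.restrict_pi_pi,
    lintegral_pi_fin_prod _ _ hf]
  exact Finset.prod_congr rfl fun i _ => (withDensity_apply _ (hs i)).symm

lemma stdGaussian_absolutelyContinuous (p : ℕ) :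
    stdGaussian (Vec p) ≪ (volume : Measure (Vec p)) := by
  rw [← map_pi_eq_stdGaussian, ← (PiLp.volume_preserving_toLp (Fin p)).map_eq]
  refine Measure.AbsolutelyContinuous.map ?_ (PiLp.volume_preserving_toLp (Fin p)).measurable
  have h : gaussianReal 0 1 = volume.withDensity (gaussianPDF 0 1) :=
    gaussianReal_of_var_ne_zero 0 one_ne_zero
  have : SigmaFinite ((volume : Measure ℝ).withDensity (gaussianPDF 0 1)) := by
    rw [← h]; infer_instance
  rw [h, pi_withDensity _ _ fun _ => measurable_gaussianPDF 0 1]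
  exact withDensity_absolutelyContinuous _ _

lemma linearMap_det_toEuclideanCLM {p : ℕ} (S : Mat p) :
    LinearMap.det (Matrix.toEuclideanCLM (𝕜 := ℝ) S : Vec p →ₗ[ℝ] Vec p) = S.det := by
  exact LinearMap.det_toLin _ S

lemma map_affineMap_volume {p : ℕ} (a : Vec p) {S : Mat p} (hS : S.det ≠ 0) :
    (volume : Measure (Vec p)).map (affineMap a S) =
      ENNReal.ofReal |S.det|⁻¹ • (volume : Measure (Vec p)) := by
  have h : affineMap a S = (fun y => a + y) ∘ (Matrix.toEuclideanCLM (𝕜 := ℝ) S) := rfl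
  rw [h, ← Measure.map_map (measurable_const_add a) (by fun_prop)]
  have h2 := Measure.map_linearMap_addHaar_eq_smul_addHaar (volume : Measure (Vec p))
    (f := (Matrix.toEuclideanCLM (𝕜 := ℝ) S : Vec p →ₗ[ℝ] Vec p))
    (by rwa [linearMap_det_toEuclideanCLM])
  rw [linearMap_det_toEuclideanCLM, abs_inv] at h2
  rw [show ⇑(Matrix.toEuclideanCLM (𝕜 := ℝ) S) =
    ⇑(Matrix.toEuclideanCLM (𝕜 := ℝ) S : Vec p →ₗ[ℝ] Vec p) from rfl, h2, Measure.map_smul,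
    map_add_left_eq_self]

lemma absolutelyContinuous_map_affineMap {p : ℕ} (a : Vec p) {S : Mat p} (hS : S.det ≠ 0)
    {F : Measure (Vec p)} (hF : F ≪ volume) : F.map (affineMap a S) ≪ volume := by
  refine (hF.map (measurable_affineMap a S)).trans ?_
  rw [map_affineMap_volume a hS]
  exact Measure.smul_absolutelyContinuous

lemma multivariateGaussian_mul_transpose {p : ℕ} (a : Vec p) {L : Mat p} (hL : L.det ≠ 0) :
    multivariateGaussian a (L * L.transpose) = (stdGaussian (Vec p)).map (affineMap a L) := by
  rw [← multivariateGaussian_zero_one, multivariateGaussian_map_affineMap a hL]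
  simp [affineMap]

open scoped MatrixOrder in
lemma multivariateGaussian_absolutelyContinuous {p : ℕ} (u : Vec p) {V : Mat p} (hV : V.PosDef) :
    multivariateGaussian u V ≪ volume := by
  refine absolutelyContinuous_map_affineMap u (S := CFC.sqrt V) ?_
    (stdGaussian_absolutelyContinuous p)
  intro h
  have h1 : CFC.sqrt V * CFC.sqrt V = V := CFC.sqrt_mul_sqrt_self V hV.posSemidef.nonneg
  have h2 := hV.det_pos
  rw [← h1, Matrix.det_mul, h] at h2
  simp at h2

/-! ### Triangular matrices -/

lemma blockTriangular_of_mem_posTriangular {p : ℕ} {L : Mat p} (hL : L ∈ posTriangular p) :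
    L.BlockTriangular id := fun i j hij => hL.1 i j hij

lemma det_of_mem_posTriangular {p : ℕ} {L : Mat p} (hL : L ∈ posTriangular p) :
    L.det = ∏ j, L j j :=
  Matrix.det_of_isUpperTriangular (blockTriangular_of_mem_posTriangular hL)

lemma det_pos_of_mem_posTriangular {p : ℕ} {L : Mat p} (hL : L ∈ posTriangular p) :
    0 < L.det := by
  rw [det_of_mem_posTriangular hL]
  exact Finset.prod_pos fun j _ => hL.2 j

lemma mul_diag_of_blockTriangular {p : ℕ} {L M : Mat p} (hL : L.BlockTriangular id)
    (hM : M.BlockTriangular id) (j : Fin p) : (L * M) j j = L j j * M j j := by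
  rw [Matrix.mul_apply, Finset.sum_eq_single j]
  · intro k _ hk
    rcases lt_or_gt_of_ne hk with h | h
    · rw [hL (show id k < id j from h), zero_mul]
    · rw [hM (show id j < id k from h), mul_zero]
  · simp

lemma mul_mem_posTriangular {p : ℕ} {L M : Mat p} (hL : L ∈ posTriangular p)
    (hM : M ∈ posTriangular p) : L * M ∈ posTriangular p := by
  have hL' := blockTriangular_of_mem_posTriangular hL
  have hM' := blockTriangular_of_mem_posTriangular hM
  refine ⟨fun i j hij => hL'.mul hM' hij, fun j => ?_⟩
  rw [mul_diag_of_blockTriangular hL' hM']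
  exact mul_pos (hL.2 j) (hM.2 j)

lemma inv_mem_posTriangular {p : ℕ} {L : Mat p} (hL : L ∈ posTriangular p) :
    L⁻¹ ∈ posTriangular p := by
  have hu : IsUnit L.det := (det_pos_of_mem_posTriangular hL).ne'.isUnit
  have hL' := blockTriangular_of_mem_posTriangular hL
  have : Invertible L := Matrix.invertibleOfIsUnitDet L hu
  have hI : (L⁻¹).BlockTriangular id := Matrix.blockTriangular_inv_of_blockTriangular hL'
  refine ⟨fun i j hij => hI hij, fun j => ?_⟩
  have h := mul_diag_of_blockTriangular hL' hI j
  rw [Matrix.mul_nonsing_inv L hu, Matrix.one_apply_eq] at h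
  exact pos_of_mul_pos_right (h ▸ one_pos) (hL.2 j).le

/-- Every positive definite matrix is conjugated to a diagonal one by an invertible upper
triangular matrix. -/
lemma exists_blockTriangular_conj_eq_diagonal {p : ℕ} {M : Mat p} (hM : M.PosDef) :
    ∃ W : Mat p, W.BlockTriangular id ∧ IsUnit W.det ∧ ∃ d : Fin p → ℝ,
      W * M * W.transpose = Matrix.diagonal d := by
  -- `LDL` produces a lower triangular factor; reversing the order of the indices makes it upper
  -- triangular.
  let e : (Fin p)ᵒᵈ ≃ Fin p := OrderDual.ofDual
  have hM' : (M.submatrix e e).PosDef := hM.submatrix e.injective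
  let W := LDL.lowerInv hM'
  refine ⟨W.submatrix e.symm e.symm, ?_, ?_, LDL.diagEntries hM' ∘ e.symm, ?_⟩
  · intro i j hij
    exact LDL.lowerInv_triangular hM' (i := e.symm i) (j := e.symm j) hij
  · rw [Matrix.det_submatrix_equiv_self]
    exact Matrix.isUnit_det_of_invertible W
  · have h := congrArg (fun A => A.submatrix e.symm e.symm) (LDL.diag_eq_lowerInv_conj hM')
    simp only [LDL.diag, Matrix.submatrix_diagonal_equiv] at h
    rw [h]
    simp only [Matrix.conjTranspose_eq_transpose_of_trivial]
    rw [← Matrix.submatrix_mul_equiv _ _ _ e.symm, ← Matrix.submatrix_mul_equiv _ _ _ e.symm]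
    simp [W]

/-- From `W M W' = diag d`, the matrix `W⁻¹ diag(√d)` is an upper triangular square root of `M`;
changing signs of its columns makes the diagonal positive. -/
lemma exists_posTriangular_mul_transpose {p : ℕ} {M : Mat p} (hM : M.PosDef) :
    ∃ T ∈ posTriangular p, T * T.transpose = M := by
  obtain ⟨W, hW, hu, d, hd⟩ := exists_blockTriangular_conj_eq_diagonal hM
  have hdpos : ∀ i, 0 < d i := by
    have h : (W * M * W.transpose).PosDef := by
      have := hM.mul_mul_conjTranspose_same (B := W)
        (Matrix.vecMul_injective_iff_isUnit.2 ((Matrix.isUnit_iff_isUnit_det W).2 hu))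
      simpa using this
    rw [hd] at h
    exact Matrix.posDef_diagonal_iff.1 h
  have : Invertible W := Matrix.invertibleOfIsUnitDet W hu
  have hI : (W⁻¹).BlockTriangular id := Matrix.blockTriangular_inv_of_blockTriangular hW
  have hne : ∀ j, W⁻¹ j j ≠ 0 := by
    intro j h0
    have h := mul_diag_of_blockTriangular hW hI j
    rw [Matrix.mul_nonsing_inv W hu, Matrix.one_apply_eq, h0, mul_zero] at h
    exact one_ne_zero h
  -- The signs correct the diagonal of `W⁻¹` and disappear from `T T'` since their squares are `1`.
  let s : Fin p → ℝ := fun j => SignType.sign (W⁻¹ j j)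
  have hs : ∀ j, s j * s j = 1 := by
    intro j
    rcases lt_or_gt_of_ne (hne j) with h | h <;> simp [s, h]
  refine ⟨W⁻¹ * Matrix.diagonal fun j => √(d j) * s j, ⟨fun i j hij => ?_, fun j => ?_⟩, ?_⟩
  · rw [Matrix.mul_diagonal, hI hij, zero_mul]
  · rw [Matrix.mul_diagonal, mul_comm (√(d j)), ← mul_assoc]
    refine mul_pos ?_ (Real.sqrt_pos.2 (hdpos j))
    rw [mul_comm, sign_mul_self]
    exact abs_pos.2 (hne j)
  · rw [Matrix.transpose_mul, Matrix.diagonal_transpose, Matrix.mul_assoc,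
      ← Matrix.mul_assoc (Matrix.diagonal _), Matrix.diagonal_mul_diagonal]
    have h1 : (fun i => √(d i) * s i * (√(d i) * s i)) = d := by
      ext i
      rw [mul_mul_mul_comm, hs, mul_one, Real.mul_self_sqrt (hdpos i).le]
    rw [h1, ← hd, ← Matrix.mul_assoc, ← Matrix.mul_assoc, ← Matrix.mul_assoc,
      Matrix.nonsing_inv_mul W hu, Matrix.one_mul, Matrix.mul_assoc,
      ← Matrix.transpose_mul, Matrix.nonsing_inv_mul W hu,
      Matrix.transpose_one, Matrix.mul_one]

/-- A nonsingular matrix is the product of a matrix in `𝕋_p` and an orthogonal matrix. -/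
lemma exists_posTriangular_mul_orthogonal {p : ℕ} {g : Mat p} (hg : g.det ≠ 0) :
    ∃ T ∈ posTriangular p, ∃ A ∈ Matrix.orthogonalGroup (Fin p) ℝ, g = T * A := by
  have hgu : IsUnit g := (Matrix.isUnit_iff_isUnit_det g).2 hg.isUnit
  have hM : (g * g.transpose).PosDef := by
    have := Matrix.PosDef.one.mul_mul_conjTranspose_same (R := ℝ) (B := g)
      (Matrix.vecMul_injective_iff_isUnit.2 hgu)
    simpa using this
  -- With `T T' = g g'`, the matrix `T⁻¹ g` is orthogonal.
  obtain ⟨T, hT, h⟩ := exists_posTriangular_mul_transpose hM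
  have hu : IsUnit T.det := (det_pos_of_mem_posTriangular hT).ne'.isUnit
  refine ⟨T, hT, T⁻¹ * g, ?_, ?_⟩
  · rw [Matrix.mem_orthogonalGroup_iff, Matrix.transpose_mul, Matrix.mul_assoc,
      ← Matrix.mul_assoc g, ← h, Matrix.mul_assoc, ← Matrix.transpose_mul,
      Matrix.nonsing_inv_mul T hu, Matrix.transpose_one, Matrix.mul_one,
      Matrix.nonsing_inv_mul T hu]
  · rw [← Matrix.mul_assoc, Matrix.mul_nonsing_inv T hu, Matrix.one_mul]

/-! ### Linear changes of variables -/

lemma lintegral_comp_mulVec {ι : Type*} [Fintype ι] [DecidableEq ι] {M : Matrix ι ι ℝ}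
    (hM : M.det ≠ 0) {f : (ι → ℝ) → ℝ≥0∞} (hf : Measurable f) :
    ∫⁻ t, f (M.mulVec t) = ENNReal.ofReal |M.det|⁻¹ * ∫⁻ t, f t := by
  have hm : Measurable fun t : ι → ℝ => M.mulVec t :=
    (Continuous.matrix_mulVec continuous_const continuous_id).measurable
  have h := Real.map_matrix_volume_pi_eq_smul_volume_pi hM
  have h1 : ∫⁻ t, f (M.mulVec t) = ∫⁻ t, f t ∂(volume.map (Matrix.toLin' M)) :=
    (lintegral_map hf hm).symm
  rw [h1, h, lintegral_smul_measure, abs_inv, smul_eq_mul]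

lemma lintegral_const_mul_comp_mulVec {ι : Type*} [Fintype ι] [DecidableEq ι] {M : Matrix ι ι ℝ}
    (hM : M.det ≠ 0) (c : ℝ≥0∞) {f : (ι → ℝ) → ℝ≥0∞} (hf : Measurable f) :
    ∫⁻ t, c * f (M.mulVec t) = c * (ENNReal.ofReal |M.det|⁻¹ * ∫⁻ t, f t) := by
  have hm : Measurable fun t : ι → ℝ => M.mulVec t :=
    (Continuous.matrix_mulVec continuous_const continuous_id).measurable
  rw [lintegral_const_mul c (f := fun t => f (M.mulVec t)) (hf.comp hm),
    lintegral_comp_mulVec hM hf]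

/-! ### Measures on matrices -/

lemma continuous_upperMatrix {p : ℕ} : Continuous (upperMatrix (p := p)) := by
  refine continuous_pi fun i => continuous_pi fun j => ?_
  by_cases h : i ≤ j
  · simpa [upperMatrix, h] using continuous_apply (⟨(i, j), h⟩ : UpperIndex p)
  · simpa [upperMatrix, h] using continuous_const

lemma measurable_upperMatrix {p : ℕ} : Measurable (upperMatrix (p := p)) :=
  continuous_upperMatrix.measurable

lemma blockTriangular_upperMatrix {p : ℕ} (t : UpperIndex p → ℝ) :
    (upperMatrix t).BlockTriangular id := by
  intro i j hij
  simp [upperMatrix, not_le.2 (show j < i from hij)]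

lemma upperMatrix_injective {p : ℕ} : Function.Injective (upperMatrix (p := p)) := by
  intro s t h
  ext q
  have := congrFun (congrFun h q.1.1) q.1.2
  simpa [upperMatrix, q.2] using this

lemma measurableSet_posTriangular (p : ℕ) : MeasurableSet (posTriangular p) := by
  have hij : ∀ i j : Fin p, Measurable fun L : Mat p => L i j := fun i j =>
    (measurable_pi_apply j).comp (measurable_pi_apply i)
  have h : posTriangular p = (⋂ i, ⋂ j, {L | j < i → L i j = 0}) ∩ ⋂ j, {L | 0 < L j j} := by
    ext L
    simp [posTriangular]
  rw [h]
  refine (MeasurableSet.iInter fun i => MeasurableSet.iInter fun j => ?_).inter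
    (MeasurableSet.iInter fun j => measurableSet_lt measurable_const (hij j j))
  by_cases hji : j < i
  · simp only [hji, true_imp_iff]
    exact hij i j (measurableSet_singleton 0)
  · simp [hji]

/-- The density of the left Haar measure of `𝕋_p`. -/
noncomputable def haarWeight {p : ℕ} (L : Mat p) : ℝ :=
  ∏ j : Fin p, L j j ^ (((j : ℕ) : ℤ) + 1 - (p : ℤ) - 1)

/-- The left Haar measure of `𝕋_p`, as a measure on matrices. -/
noncomputable def haarTriangular (p : ℕ) : Measure (Mat p) :=
  ((triangularLebesgue p).restrict (posTriangular p)).withDensity fun L =>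
    ENNReal.ofReal (haarWeight L)

instance instSFiniteHaarTriangular (p : ℕ) : SFinite (haarTriangular p) := by
  unfold haarTriangular triangularLebesgue
  infer_instance

lemma haarPrior_eq_prod (p : ℕ) :
    haarPrior p = (volume : Measure (Vec p)).prod (haarTriangular p) := rfl

lemma measurable_haarWeight {p : ℕ} : Measurable (haarWeight (p := p)) := by
  refine Finset.measurable_prod _ fun j _ => ?_
  have hj : Measurable fun L : Mat p => L j j :=
    (measurable_pi_apply j).comp (measurable_pi_apply j)
  exact hj.pow_const _

lemma haarWeight_pos {p : ℕ} {L : Mat p} (hL : L ∈ posTriangular p) : 0 < haarWeight L :=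
  Finset.prod_pos fun j _ => zpow_pos (hL.2 j) _

lemma haarWeight_mul {p : ℕ} {L M : Mat p} (hL : L.BlockTriangular id)
    (hM : M.BlockTriangular id) : haarWeight (L * M) = haarWeight L * haarWeight M := by
  simp only [haarWeight, mul_diag_of_blockTriangular hL hM, mul_zpow, Finset.prod_mul_distrib]

lemma ae_mem_posTriangular (p : ℕ) : ∀ᵐ L ∂haarTriangular p, L ∈ posTriangular p :=
  (withDensity_absolutelyContinuous _ _).ae_le
    (ae_restrict_mem (measurableSet_posTriangular p))

lemma lintegral_haarTriangular {p : ℕ} {f : Mat p → ℝ≥0∞} (hf : Measurable f) :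
    ∫⁻ L, f L ∂haarTriangular p = ∫⁻ t : UpperIndex p → ℝ,
      (posTriangular p).indicator (fun L => ENNReal.ofReal (haarWeight L) * f L)
        (upperMatrix t) := by
  have hw : Measurable fun L : Mat p => ENNReal.ofReal (haarWeight L) :=
    measurable_haarWeight.ennreal_ofReal
  rw [haarTriangular, lintegral_withDensity_eq_lintegral_mul _ hw hf,
    ← lintegral_indicator (measurableSet_posTriangular p), triangularLebesgue,
    lintegral_map ((hw.mul hf).indicator (measurableSet_posTriangular p)) measurable_upperMatrix]
  rfl

/-- The matrix of `Λ ↦ T Λ` in the coordinates on and above the diagonal. -/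
def leftMulUpper {p : ℕ} (T : Mat p) : Matrix (UpperIndex p) (UpperIndex p) ℝ :=
  Matrix.of fun q r => if q.1.2 = r.1.2 then T q.1.1 r.1.1 else 0

/-- The matrix of `Λ ↦ Λ T` in the coordinates on and above the diagonal. -/
def rightMulUpper {p : ℕ} (T : Mat p) : Matrix (UpperIndex p) (UpperIndex p) ℝ :=
  Matrix.of fun q r => if q.1.1 = r.1.1 then T r.1.2 q.1.2 else 0

lemma sum_upperIndex {p : ℕ} (f : Fin p × Fin p → ℝ) :
    ∑ r : UpperIndex p, f r.1 = ∑ i, ∑ j, if i ≤ j then f (i, j) else 0 := by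
  rw [← Fintype.sum_prod_type' (f := fun i j => if i ≤ j then f (i, j) else 0),
    ← Finset.sum_filter (s := Finset.univ) (p := fun q : Fin p × Fin p => q.1 ≤ q.2)]
  exact (Finset.sum_subtype _ (by simp) f).symm

lemma upperMatrix_leftMulUpper {p : ℕ} {T : Mat p} (hT : T.BlockTriangular id)
    (t : UpperIndex p → ℝ) : upperMatrix ((leftMulUpper T).mulVec t) = T * upperMatrix t := by
  ext i j
  by_cases hij : i ≤ j
  · have hl : upperMatrix ((leftMulUpper T).mulVec t) i j =
        ∑ r : UpperIndex p, (if j = r.1.2 then T i r.1.1 else 0) * t r := by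
      simp [upperMatrix, hij, Matrix.mulVec, dotProduct, leftMulUpper]
    have h1 : ∀ r : UpperIndex p, (if j = r.1.2 then T i r.1.1 else 0) * t r =
        (if j = r.1.2 then T i r.1.1 else 0) * upperMatrix t r.1.1 r.1.2 := by
      intro r
      simp [upperMatrix, r.2]
    rw [hl, Finset.sum_congr rfl fun r _ => h1 r, Matrix.mul_apply,
      sum_upperIndex fun q => (if j = q.2 then T i q.1 else 0) * upperMatrix t q.1 q.2]
    refine Finset.sum_congr rfl fun k _ => ?_
    rw [Finset.sum_eq_single j]
    · by_cases hk : k ≤ j <;> simp [hk, upperMatrix]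
    · intro l _ hl
      simp [hl.symm]
    · simp
  · rw [blockTriangular_upperMatrix _ (not_le.1 hij),
      (hT.mul (blockTriangular_upperMatrix t)) (not_le.1 hij)]

lemma upperMatrix_rightMulUpper {p : ℕ} {T : Mat p} (hT : T.BlockTriangular id)
    (t : UpperIndex p → ℝ) : upperMatrix ((rightMulUpper T).mulVec t) = upperMatrix t * T := by
  ext i j
  by_cases hij : i ≤ j
  · have hl : upperMatrix ((rightMulUpper T).mulVec t) i j =
        ∑ r : UpperIndex p, (if i = r.1.1 then T r.1.2 j else 0) * t r := by
      simp [upperMatrix, hij, Matrix.mulVec, dotProduct, rightMulUpper]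
    have h1 : ∀ r : UpperIndex p, (if i = r.1.1 then T r.1.2 j else 0) * t r =
        (if i = r.1.1 then T r.1.2 j else 0) * upperMatrix t r.1.1 r.1.2 := by
      intro r
      simp [upperMatrix, r.2]
    rw [hl, Finset.sum_congr rfl fun r _ => h1 r, Matrix.mul_apply,
      sum_upperIndex fun q => (if i = q.1 then T q.2 j else 0) * upperMatrix t q.1 q.2,
      Finset.sum_eq_single i]
    · refine Finset.sum_congr rfl fun k _ => ?_
      by_cases hk : i ≤ k <;> simp [hk, upperMatrix, mul_comm]
    · intro l _ hl
      simp [hl.symm]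
    · simp
  · rw [blockTriangular_upperMatrix _ (not_le.1 hij),
      ((blockTriangular_upperMatrix t).mul hT) (not_le.1 hij)]

/-- Grouped by row index, the coordinates make `Λ ↦ T Λ` block triangular. The block of row `a` is
the scalar `T a a` on the `p - a` columns `j ≥ a`, with indices starting at `0`. This exponent is
exactly what the prior weight compensates. -/
lemma det_leftMulUpper {p : ℕ} {T : Mat p} (hT : T.BlockTriangular id) :
    (leftMulUpper T).det = ∏ a : Fin p, T a a ^ (p - (a : ℕ)) := by
  have hb : (leftMulUpper T).BlockTriangular fun q : UpperIndex p => q.1.1 := by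
    intro q r hqr
    simp [leftMulUpper, hT (show id r.1.1 < id q.1.1 from hqr)]
  rw [hb.det_fintype]
  refine Finset.prod_congr rfl fun a _ => ?_
  have hd : (leftMulUpper T).toSquareBlock (fun q : UpperIndex p => q.1.1) a =
      Matrix.diagonal fun _ => T a a := by
    ext q r
    by_cases h : q = r
    · subst h
      simp [Matrix.toSquareBlock_def, leftMulUpper, q.2]
    · have h2 : q.1.1.2 ≠ r.1.1.2 := by
        intro h2
        refine h (Subtype.ext (Subtype.ext (Prod.ext ?_ h2)))
        exact q.2.trans r.2.symm
      simp [Matrix.toSquareBlock_def, leftMulUpper, h, h2]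
  rw [hd, Matrix.det_diagonal, Finset.prod_const, Finset.card_univ]
  congr 1
  rw [← Fin.card_Ici, ← Fintype.card_coe]
  refine Fintype.card_congr ⟨fun q => ⟨q.1.1.2, ?_⟩, fun j => ⟨⟨(a, j.1), ?_⟩, rfl⟩, ?_, ?_⟩
  · have h1 := q.1.2
    rw [q.2] at h1
    exact Finset.mem_Ici.2 h1
  · exact Finset.mem_Ici.1 j.2
  · rintro ⟨⟨⟨i, j⟩, hij⟩, rfl⟩
    rfl
  · intro j
    rfl

lemma haarWeight_mul_det_leftMulUpper {p : ℕ} {T : Mat p} (hT : T ∈ posTriangular p) :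
    haarWeight T * (leftMulUpper T).det = 1 := by
  rw [det_leftMulUpper (blockTriangular_of_mem_posTriangular hT), haarWeight,
    ← Finset.prod_mul_distrib]
  refine Finset.prod_eq_one fun a _ => ?_
  rw [← zpow_natCast, ← zpow_add₀ (hT.2 a).ne', Nat.cast_sub a.2.le]
  rw [show ((a : ℕ) : ℤ) + 1 - p - 1 + (p - ((a : ℕ) : ℤ)) = 0 by ring, zpow_zero]

lemma mul_mem_posTriangular_iff_right {p : ℕ} {T L : Mat p} (hT : T ∈ posTriangular p) :
    T * L ∈ posTriangular p ↔ L ∈ posTriangular p := by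
  refine ⟨fun h => ?_, mul_mem_posTriangular hT⟩
  have h1 := mul_mem_posTriangular (inv_mem_posTriangular hT) h
  rwa [← Matrix.mul_assoc, Matrix.nonsing_inv_mul T (det_pos_of_mem_posTriangular hT).ne'.isUnit,
    Matrix.one_mul] at h1

lemma mul_mem_posTriangular_iff_left {p : ℕ} {T L : Mat p} (hT : T ∈ posTriangular p) :
    L * T ∈ posTriangular p ↔ L ∈ posTriangular p := by
  refine ⟨fun h => ?_, fun h => mul_mem_posTriangular h hT⟩
  have h1 := mul_mem_posTriangular h (inv_mem_posTriangular hT)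
  rwa [Matrix.mul_assoc, Matrix.mul_nonsing_inv T (det_pos_of_mem_posTriangular hT).ne'.isUnit,
    Matrix.mul_one] at h1

lemma measurable_mul_left {p : ℕ} (S : Mat p) : Measurable fun X : Mat p => S * X :=
  measurable_matrix_mul.comp (measurable_const.prodMk measurable_id)

lemma measurable_mul_right {p : ℕ} (S : Mat p) : Measurable fun X : Mat p => X * S :=
  measurable_matrix_mul.comp (measurable_id.prodMk measurable_const)

/-- Left invariance of the Haar measure of `𝕋_p`. -/
lemma lintegral_haarTriangular_mul_left {p : ℕ} {T : Mat p} (hT : T ∈ posTriangular p)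
    {f : Mat p → ℝ≥0∞} (hf : Measurable f) :
    ∫⁻ L, f (T * L) ∂haarTriangular p = ∫⁻ L, f L ∂haarTriangular p := by
  have hTb := blockTriangular_of_mem_posTriangular hT
  have hdet := haarWeight_mul_det_leftMulUpper hT
  have hdet0 : (leftMulUpper T).det ≠ 0 := right_ne_zero_of_mul (hdet ▸ one_ne_zero)
  have hw : Measurable fun L : Mat p => ENNReal.ofReal (haarWeight L) :=
    measurable_haarWeight.ennreal_ofReal
  rw [lintegral_haarTriangular hf,
    lintegral_haarTriangular (f := fun L => f (T * L)) (hf.comp (measurable_mul_left T))]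
  set G := (posTriangular p).indicator fun L => ENNReal.ofReal (haarWeight L) * f L with hG
  have hGm : Measurable G := (hw.mul hf).indicator (measurableSet_posTriangular p)
  -- Since `haarWeight` is multiplicative and `T Λ ∈ 𝕋_p` exactly when `Λ ∈ 𝕋_p`, the integrand is a
  -- constant times a function of `T Λ`.
  have h1 : ∀ t : UpperIndex p → ℝ,
      (posTriangular p).indicator (fun L => ENNReal.ofReal (haarWeight L) * f (T * L))
        (upperMatrix t) = ENNReal.ofReal (haarWeight T)⁻¹ *
          G (upperMatrix ((leftMulUpper T).mulVec t)) := by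
    intro t
    rw [upperMatrix_leftMulUpper hTb, hG]
    by_cases ht : upperMatrix t ∈ posTriangular p
    · rw [Set.indicator_of_mem ht, Set.indicator_of_mem (mul_mem_posTriangular hT ht),
        haarWeight_mul hTb (blockTriangular_upperMatrix t), ← mul_assoc,
        ← ENNReal.ofReal_mul (inv_nonneg.2 (haarWeight_pos hT).le), ← mul_assoc,
        inv_mul_cancel₀ (haarWeight_pos hT).ne', one_mul]
    · rw [Set.indicator_of_notMem ht,
        Set.indicator_of_notMem (fun h => ht ((mul_mem_posTriangular_iff_right hT).1 h)),
        mul_zero]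
  have hGu : Measurable fun t => G (upperMatrix t) := hGm.comp measurable_upperMatrix
  rw [lintegral_congr h1, lintegral_const_mul_comp_mulVec hdet0 _ hGu, ← mul_assoc,
    ← ENNReal.ofReal_mul (inv_nonneg.2 (haarWeight_pos hT).le)]
  have h2 : (haarWeight T)⁻¹ * |(leftMulUpper T).det|⁻¹ = 1 := by
    rw [← mul_inv, ← abs_of_pos (haarWeight_pos hT), ← abs_mul, hdet, abs_one, inv_one]
  rw [h2, ENNReal.ofReal_one, one_mul]

/-- Right multiplication by `T` is undone by `T⁻¹`. Nonvanishing suffices, as the value of the right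
multiplier plays no role later. -/
lemma det_rightMulUpper_ne_zero {p : ℕ} {T : Mat p} (hT : T ∈ posTriangular p) :
    (rightMulUpper T).det ≠ 0 := by
  have hu : IsUnit T.det := (det_pos_of_mem_posTriangular hT).ne'.isUnit
  refine IsUnit.ne_zero ((Matrix.isUnit_iff_isUnit_det _).1
    (Matrix.mulVec_injective_iff_isUnit.1 fun s t hst => upperMatrix_injective ?_))
  have h := congrArg upperMatrix hst
  rw [upperMatrix_rightMulUpper (blockTriangular_of_mem_posTriangular hT),
    upperMatrix_rightMulUpper (blockTriangular_of_mem_posTriangular hT)] at h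
  have h2 := congrArg (fun X => X * T⁻¹) h
  simpa only [Matrix.mul_assoc, Matrix.mul_nonsing_inv T hu, Matrix.mul_one] using h2

/-- Right translations multiply the Haar measure of `𝕋_p` by constants. -/
lemma exists_lintegral_haarTriangular_mul_right {p : ℕ} {T : Mat p} (hT : T ∈ posTriangular p) :
    ∃ c : ℝ≥0∞, ∀ f : Mat p → ℝ≥0∞, Measurable f →
      ∫⁻ L, f (L * T) ∂haarTriangular p = c * ∫⁻ L, f L ∂haarTriangular p := by
  have hTb := blockTriangular_of_mem_posTriangular hT
  have hdet0 := det_rightMulUpper_ne_zero hT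
  have hw : Measurable fun L : Mat p => ENNReal.ofReal (haarWeight L) :=
    measurable_haarWeight.ennreal_ofReal
  refine ⟨ENNReal.ofReal (haarWeight T)⁻¹ * ENNReal.ofReal |(rightMulUpper T).det|⁻¹,
    fun f hf => ?_⟩
  rw [lintegral_haarTriangular hf,
    lintegral_haarTriangular (f := fun L => f (L * T)) (hf.comp (measurable_mul_right T))]
  set G := (posTriangular p).indicator fun L => ENNReal.ofReal (haarWeight L) * f L with hG
  have hGm : Measurable G := (hw.mul hf).indicator (measurableSet_posTriangular p)
  have h1 : ∀ t : UpperIndex p → ℝ,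
      (posTriangular p).indicator (fun L => ENNReal.ofReal (haarWeight L) * f (L * T))
        (upperMatrix t) = ENNReal.ofReal (haarWeight T)⁻¹ *
          G (upperMatrix ((rightMulUpper T).mulVec t)) := by
    intro t
    rw [upperMatrix_rightMulUpper hTb, hG]
    by_cases ht : upperMatrix t ∈ posTriangular p
    · rw [Set.indicator_of_mem ht, Set.indicator_of_mem (mul_mem_posTriangular ht hT),
        haarWeight_mul (blockTriangular_upperMatrix t) hTb, ← mul_assoc,
        ← ENNReal.ofReal_mul (inv_nonneg.2 (haarWeight_pos hT).le), mul_comm (haarWeight _),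
        ← mul_assoc, inv_mul_cancel₀ (haarWeight_pos hT).ne', one_mul]
    · rw [Set.indicator_of_notMem ht,
        Set.indicator_of_notMem (fun h => ht ((mul_mem_posTriangular_iff_left hT).1 h)),
        mul_zero]
  have hGu : Measurable fun t => G (upperMatrix t) := hGm.comp measurable_upperMatrix
  rw [lintegral_congr h1, lintegral_const_mul_comp_mulVec hdet0 _ hGu, ← mul_assoc]

/-! ### The Haar measure of the general linear group -/

/-- The matrix with the given entries. -/
def fullMatrix {p : ℕ} (x : Fin p × Fin p → ℝ) : Mat p := Matrix.of fun i j => x (i, j)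

/-- The Haar measure `|det X|⁻ᵖ dX` of the general linear group, as a measure on matrices. -/
noncomputable def haarGeneralLinear (p : ℕ) : Measure (Mat p) :=
  ((volume : Measure (Fin p × Fin p → ℝ)).map fullMatrix).withDensity fun X =>
    ENNReal.ofReal (|X.det|⁻¹ ^ p)

instance instSFiniteHaarGeneralLinear (p : ℕ) : SFinite (haarGeneralLinear p) := by
  unfold haarGeneralLinear
  infer_instance

lemma continuous_fullMatrix {p : ℕ} : Continuous (fullMatrix (p := p)) :=
  continuous_pi fun i => continuous_pi fun j => continuous_apply (i, j)

lemma measurable_generalLinearWeight {p : ℕ} :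
    Measurable fun X : Mat p => ENNReal.ofReal (|X.det|⁻¹ ^ p) :=
  ((measurable_matrix_det.abs.inv).pow_const p).ennreal_ofReal

lemma lintegral_haarGeneralLinear {p : ℕ} {f : Mat p → ℝ≥0∞} (hf : Measurable f) :
    ∫⁻ X, f X ∂haarGeneralLinear p = ∫⁻ x : Fin p × Fin p → ℝ,
      ENNReal.ofReal (|(fullMatrix x).det|⁻¹ ^ p) * f (fullMatrix x) := by
  rw [haarGeneralLinear, lintegral_withDensity_eq_lintegral_mul _ measurable_generalLinearWeight hf,
    lintegral_map (measurable_generalLinearWeight.mul hf) continuous_fullMatrix.measurable]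
  rfl

/-- For `p > 0` the weight is `0` at singular matrices because `0⁻¹ = 0`, so their Lebesgue measure
need not be known; for `p = 0` the determinant is `1`. -/
lemma ae_det_ne_zero_haarGeneralLinear (p : ℕ) : ∀ᵐ X ∂haarGeneralLinear p, X.det ≠ 0 := by
  rw [haarGeneralLinear, ae_withDensity_iff measurable_generalLinearWeight]
  refine Eventually.of_forall fun X hX h => hX ?_
  rcases Nat.eq_zero_or_pos p with rfl | hp
  · simp at h
  · simp [h, hp.ne']

/-- Exhibits left multiplication as `S ⊗ 1`, whose determinant `(det S)ᵖ` matches the weight `|det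
X|⁻ᵖ`. -/
lemma fullMatrix_kronecker {p : ℕ} (S : Mat p) (x : Fin p × Fin p → ℝ) :
    fullMatrix ((Matrix.kroneckerMap (· * ·) S (1 : Mat p)).mulVec x) = S * fullMatrix x := by
  ext i j
  simp [fullMatrix, Matrix.mulVec, dotProduct, Matrix.mul_apply, Fintype.sum_prod_type,
    Matrix.one_apply]

lemma lintegral_haarGeneralLinear_mul_left {p : ℕ} {S : Mat p} (hS : S.det ≠ 0)
    {f : Mat p → ℝ≥0∞} (hf : Measurable f) :
    ∫⁻ X, f (S * X) ∂haarGeneralLinear p = ∫⁻ X, f X ∂haarGeneralLinear p := by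
  rw [lintegral_haarGeneralLinear hf,
    lintegral_haarGeneralLinear (f := fun X => f (S * X)) (hf.comp (measurable_mul_left S))]
  have hdet : (Matrix.kroneckerMap (· * ·) S (1 : Mat p)).det = S.det ^ p := by
    have := Matrix.det_kronecker S (1 : Mat p)
    simpa using this
  have hdet0 : (Matrix.kroneckerMap (· * ·) S (1 : Mat p)).det ≠ 0 := by
    rw [hdet]; exact pow_ne_zero _ hS
  have hG : Measurable fun x : Fin p × Fin p → ℝ =>
      ENNReal.ofReal (|(fullMatrix x).det|⁻¹ ^ p) * f (fullMatrix x) :=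
    (measurable_generalLinearWeight.mul hf).comp continuous_fullMatrix.measurable
  have h1 : ∀ x : Fin p × Fin p → ℝ,
      ENNReal.ofReal (|(fullMatrix x).det|⁻¹ ^ p) * f (S * fullMatrix x) =
      ENNReal.ofReal (|S.det| ^ p) *
        (fun x => ENNReal.ofReal (|(fullMatrix x).det|⁻¹ ^ p) * f (fullMatrix x))
          ((Matrix.kroneckerMap (· * ·) S (1 : Mat p)).mulVec x) := by
    intro x
    simp only [fullMatrix_kronecker]
    rw [← mul_assoc, ← ENNReal.ofReal_mul (by positivity), Matrix.det_mul, abs_mul, mul_inv,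
      mul_pow, ← mul_assoc, ← mul_pow, mul_inv_cancel₀ (abs_ne_zero.2 hS), one_pow, one_mul]
  rw [lintegral_congr h1, lintegral_const_mul_comp_mulVec hdet0 _ hG, ← mul_assoc,
    ← ENNReal.ofReal_mul (by positivity), hdet, abs_pow,
    mul_inv_cancel₀ (pow_ne_zero _ (abs_ne_zero.2 hS)), ENNReal.ofReal_one, one_mul]

/-! ### A bi-orthogonally invariant set of matrices -/

/-- A compact neighbourhood of the identity, invariant under multiplication by orthogonal
matrices on both sides. -/
def orthogonalBox (p : ℕ) : Set (Mat p) :=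
  {X | (X * X.transpose).trace ≤ (p : ℝ) + 1 ∧ 1 / 4 ≤ X.det ^ 2}

lemma continuous_trace_mul_transpose {p : ℕ} :
    Continuous fun X : Mat p => (X * X.transpose).trace :=
  Continuous.matrix_trace (Continuous.matrix_mul continuous_id
    (Continuous.matrix_transpose continuous_id))

lemma continuous_det_sq {p : ℕ} : Continuous fun X : Mat p => X.det ^ 2 :=
  (Continuous.matrix_det continuous_id).pow 2

lemma isClosed_orthogonalBox (p : ℕ) : IsClosed (orthogonalBox p) :=
  (isClosed_le continuous_trace_mul_transpose continuous_const).inter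
    (isClosed_le continuous_const continuous_det_sq)

lemma measurableSet_orthogonalBox (p : ℕ) : MeasurableSet (orthogonalBox p) :=
  (isClosed_orthogonalBox p).measurableSet

lemma det_ne_zero_of_mem_orthogonalBox {p : ℕ} {X : Mat p} (hX : X ∈ orthogonalBox p) :
    X.det ≠ 0 := by
  intro h
  have := hX.2
  rw [h] at this
  norm_num at this

lemma orthogonal_mul_transpose {p : ℕ} {A : Mat p} (hA : A ∈ Matrix.orthogonalGroup (Fin p) ℝ) :
    A * A.transpose = 1 := (Matrix.mem_orthogonalGroup_iff _ _).1 hA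

lemma orthogonal_transpose_mul {p : ℕ} {A : Mat p} (hA : A ∈ Matrix.orthogonalGroup (Fin p) ℝ) :
    A.transpose * A = 1 := (Matrix.mem_orthogonalGroup_iff' _ _).1 hA

lemma transpose_mem_orthogonalGroup {p : ℕ} {A : Mat p}
    (hA : A ∈ Matrix.orthogonalGroup (Fin p) ℝ) :
    A.transpose ∈ Matrix.orthogonalGroup (Fin p) ℝ := by
  rw [Matrix.mem_orthogonalGroup_iff]
  exact orthogonal_transpose_mul hA

lemma orthogonal_det_sq {p : ℕ} {A : Mat p} (hA : A ∈ Matrix.orthogonalGroup (Fin p) ℝ) :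
    A.det ^ 2 = 1 := by
  have h := congrArg Matrix.det (orthogonal_mul_transpose hA)
  rwa [Matrix.det_mul, Matrix.det_transpose, Matrix.det_one, ← sq] at h

lemma orthogonal_det_ne_zero {p : ℕ} {A : Mat p} (hA : A ∈ Matrix.orthogonalGroup (Fin p) ℝ) :
    A.det ≠ 0 := by
  intro h
  have := orthogonal_det_sq hA
  simp [h] at this

lemma orthogonal_inv {p : ℕ} {A : Mat p} (hA : A ∈ Matrix.orthogonalGroup (Fin p) ℝ) :
    A⁻¹ = A.transpose := Matrix.inv_eq_right_inv (orthogonal_mul_transpose hA)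

lemma mul_right_mem_orthogonalBox_iff {p : ℕ} {A X : Mat p}
    (hA : A ∈ Matrix.orthogonalGroup (Fin p) ℝ) :
    X * A ∈ orthogonalBox p ↔ X ∈ orthogonalBox p := by
  have h : X * A * (X * A).transpose = X * X.transpose := by
    rw [Matrix.transpose_mul, Matrix.mul_assoc, ← Matrix.mul_assoc A,
      orthogonal_mul_transpose hA, Matrix.one_mul]
  simp only [orthogonalBox, Set.mem_ofPred_eq, h, Matrix.det_mul, mul_pow, orthogonal_det_sq hA,
    mul_one]

lemma mul_left_mem_orthogonalBox_iff {p : ℕ} {A X : Mat p}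
    (hA : A ∈ Matrix.orthogonalGroup (Fin p) ℝ) :
    A * X ∈ orthogonalBox p ↔ X ∈ orthogonalBox p := by
  have h : (A * X * (A * X).transpose).trace = (X * X.transpose).trace := by
    rw [Matrix.trace_mul_comm, Matrix.transpose_mul, Matrix.mul_assoc, ← Matrix.mul_assoc _ A,
      orthogonal_transpose_mul hA, Matrix.one_mul, Matrix.trace_mul_comm]
  simp only [orthogonalBox, Set.mem_ofPred_eq, h, Matrix.det_mul, mul_pow, orthogonal_det_sq hA,
    one_mul]

lemma sq_entry_le_trace {p : ℕ} (X : Mat p) (i j : Fin p) :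
    X i j ^ 2 ≤ (X * X.transpose).trace := by
  have h : (X * X.transpose).trace = ∑ i, ∑ j, X i j ^ 2 := by
    simp [Matrix.trace, Matrix.mul_apply, sq]
  rw [h]
  exact (Finset.single_le_sum (f := fun j => X i j ^ 2) (fun _ _ => sq_nonneg _)
    (Finset.mem_univ j)).trans (Finset.single_le_sum (f := fun i => ∑ j, X i j ^ 2)
      (fun _ _ => Finset.sum_nonneg fun _ _ => sq_nonneg _) (Finset.mem_univ i))

/-- The trace is the sum of the squared entries, hence bounds each coordinate by `√(p + 1)`. The
parametrization `e` is left general to serve both full and triangular matrices. -/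
lemma isCompact_preimage_orthogonalBox {p : ℕ} {ι : Type*} [Fintype ι] {e : (ι → ℝ) → Mat p}
    (he : Continuous e) (hcoord : ∀ t q, ∃ i j, t q = e t i j) :
    IsCompact (e ⁻¹' orthogonalBox p) := by
  refine Metric.isCompact_of_isClosed_isBounded ((isClosed_orthogonalBox p).preimage he)
    ((Metric.isBounded_iff_subset_closedBall 0).2 ⟨√((p : ℝ) + 1), fun t ht => ?_⟩)
  rw [mem_closedBall_zero_iff, pi_norm_le_iff_of_nonneg (Real.sqrt_nonneg _)]
  intro q
  obtain ⟨i, j, hij⟩ := hcoord t q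
  rw [Real.norm_eq_abs, hij]
  exact Real.abs_le_sqrt ((sq_entry_le_trace (e t) i j).trans ht.1)

lemma haarGeneralLinear_orthogonalBox_ne_top (p : ℕ) :
    haarGeneralLinear p (orthogonalBox p) ≠ ∞ := by
  have hK := measurableSet_orthogonalBox p
  have hc := isCompact_preimage_orthogonalBox (p := p) continuous_fullMatrix
    fun t q => ⟨q.1, q.2, rfl⟩
  have hcont : ContinuousOn (fun x : Fin p × Fin p → ℝ => |(fullMatrix x).det|⁻¹ ^ p)
      (fullMatrix ⁻¹' orthogonalBox p) := by
    refine ContinuousOn.pow (ContinuousOn.inv₀ (Continuous.continuousOn ?_) fun x hx => ?_) p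
    · exact ((Continuous.matrix_det continuous_id).comp continuous_fullMatrix).abs
    · exact abs_ne_zero.2 (det_ne_zero_of_mem_orthogonalBox hx)
  have hfin := (hcont.integrableOn_compact hc (μ := volume)).lintegral_lt_top
  rw [← lintegral_indicator_one hK, lintegral_haarGeneralLinear (measurable_one.indicator hK)]
  rw [← lintegral_indicator (continuous_fullMatrix.measurable hK)] at hfin
  refine ne_of_lt (lt_of_le_of_lt (lintegral_mono fun x => ?_) hfin)
  by_cases hx : fullMatrix x ∈ orthogonalBox p
  · simp [Set.indicator, hx]
  · simp [Set.indicator, hx]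

lemma haarTriangular_orthogonalBox_ne_top (p : ℕ) :
    haarTriangular p (orthogonalBox p) ≠ ∞ := by
  have hK := measurableSet_orthogonalBox p
  have hc := isCompact_preimage_orthogonalBox (p := p) continuous_upperMatrix
    fun t q => ⟨q.1.1, q.1.2, by simp [upperMatrix, q.2]⟩
  have hcont : ContinuousOn (fun t : UpperIndex p → ℝ => haarWeight (upperMatrix t))
      (upperMatrix ⁻¹' orthogonalBox p) := by
    refine continuousOn_finsetProd _ fun j _ => ContinuousOn.zpow₀ ?_ _ fun t ht => Or.inl ?_
    · exact ((continuous_apply_apply j j).comp continuous_upperMatrix).continuousOn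
    -- The preimage of the box is not restricted to positive diagonals; nonzero ones are enough for
    -- continuity of the negative powers.
    · have h := det_ne_zero_of_mem_orthogonalBox ht
      rw [Matrix.det_of_isUpperTriangular (blockTriangular_upperMatrix t)] at h
      exact Finset.prod_ne_zero_iff.1 h j (Finset.mem_univ j)
  have hfin := (hcont.integrableOn_compact hc (μ := volume)).lintegral_lt_top
  rw [← lintegral_indicator_one hK, lintegral_haarTriangular (measurable_one.indicator hK)]
  rw [← lintegral_indicator (measurable_upperMatrix hK)] at hfin
  refine ne_of_lt (lt_of_le_of_lt (lintegral_mono fun x => ?_) hfin)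
  by_cases hx : upperMatrix x ∈ orthogonalBox p <;>
    by_cases hx' : upperMatrix x ∈ posTriangular p <;> simp [Set.indicator, hx, hx']

/-- At the identity the trace is `p < p + 1` and the squared determinant is `1 > 1/4`, so both
constraints are strict there. This gives the box positive Haar measure. -/
lemma one_mem_open_subset_orthogonalBox (p : ℕ) : ∃ U : Set (Mat p), IsOpen U ∧ 1 ∈ U ∧
    U ⊆ orthogonalBox p := by
  refine ⟨{X | (X * X.transpose).trace < (p : ℝ) + 1} ∩ {X | 1 / 4 < X.det ^ 2},
    (isOpen_lt continuous_trace_mul_transpose continuous_const).inter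
      (isOpen_lt continuous_const continuous_det_sq), ?_, fun X hX => ⟨hX.1.le, hX.2.le⟩⟩
  constructor
  · simp
  · norm_num

lemma haarGeneralLinear_orthogonalBox_ne_zero (p : ℕ) :
    haarGeneralLinear p (orthogonalBox p) ≠ 0 := by
  have hK := measurableSet_orthogonalBox p
  obtain ⟨U, hU, hU1, hUK⟩ := one_mem_open_subset_orthogonalBox p
  have hpos : volume (fullMatrix (p := p) ⁻¹' U) ≠ 0 := by
    refine (hU.preimage continuous_fullMatrix).measure_ne_zero volume
      ⟨fun q => (1 : Mat p) q.1 q.2, ?_⟩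
    exact hU1
  have hm : Measurable fun x : Fin p × Fin p → ℝ => ENNReal.ofReal (|(fullMatrix x).det|⁻¹ ^ p) *
      (orthogonalBox p).indicator (1 : Mat p → ℝ≥0∞) (fullMatrix x) :=
    (measurable_generalLinearWeight.mul (measurable_one.indicator hK)).comp
      continuous_fullMatrix.measurable
  rw [← lintegral_indicator_one hK, lintegral_haarGeneralLinear (measurable_one.indicator hK)]
  intro h0
  rw [lintegral_eq_zero_iff hm] at h0
  refine hpos (measure_mono_null (fun x hx => ?_) (ae_iff.1 h0))
  have hx' : fullMatrix x ∈ orthogonalBox p := hUK hx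
  have hd := det_ne_zero_of_mem_orthogonalBox hx'
  simp only [Pi.zero_apply, Set.mem_ofPred_eq, Set.indicator_of_mem hx', Pi.one_apply, mul_one,
    ENNReal.ofReal_eq_zero, not_le]
  positivity

lemma haarTriangular_orthogonalBox_ne_zero (p : ℕ) :
    haarTriangular p (orthogonalBox p) ≠ 0 := by
  have hK := measurableSet_orthogonalBox p
  obtain ⟨U, hU, hU1, hUK⟩ := one_mem_open_subset_orthogonalBox p
  have hV : IsOpen {X : Mat p | ∀ j, 0 < X j j} := by
    simp only [Set.ofPred_forall]
    exact isOpen_iInter_of_finite fun j =>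
      isOpen_lt continuous_const (continuous_apply_apply j j)
  have hone : upperMatrix (fun q : UpperIndex p => (1 : Mat p) q.1.1 q.1.2) = 1 := by
    ext i j
    by_cases hij : i ≤ j
    · simp [upperMatrix, hij]
    · simp [upperMatrix, hij, Matrix.one_apply_ne (not_le.1 hij).ne']
  have hpos : volume (upperMatrix (p := p) ⁻¹' (U ∩ {X : Mat p | ∀ j, 0 < X j j})) ≠ 0 := by
    refine ((hU.inter hV).preimage continuous_upperMatrix).measure_ne_zero volume
      ⟨fun q => (1 : Mat p) q.1.1 q.1.2, ?_⟩
    rw [Set.mem_preimage, hone]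
    exact ⟨hU1, by simp⟩
  have hm : Measurable fun t : UpperIndex p → ℝ => (posTriangular p).indicator (fun L =>
      ENNReal.ofReal (haarWeight L) * (orthogonalBox p).indicator (1 : Mat p → ℝ≥0∞) L)
        (upperMatrix t) :=
    ((measurable_haarWeight.ennreal_ofReal.mul (measurable_one.indicator hK)).indicator
      (measurableSet_posTriangular p)).comp measurable_upperMatrix
  rw [← lintegral_indicator_one hK, lintegral_haarTriangular (measurable_one.indicator hK)]
  intro h0
  rw [lintegral_eq_zero_iff hm] at h0
  refine hpos (measure_mono_null (fun x hx => ?_) (ae_iff.1 h0))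
  have hx' : upperMatrix x ∈ orthogonalBox p := hUK hx.1
  have hT : upperMatrix x ∈ posTriangular p :=
    ⟨fun i j hij => blockTriangular_upperMatrix x hij, hx.2⟩
  simp only [Pi.zero_apply, Set.mem_ofPred_eq, Set.indicator_of_mem hx', Set.indicator_of_mem hT,
    Pi.one_apply, mul_one, ENNReal.ofReal_eq_zero, not_le]
  exact haarWeight_pos hT

/-! ### Invariance of the Haar measure of `𝕋_p` as a quotient measure -/

lemma indicator_one_congr {X : Type*} {s : Set X} {x y : X} (h : x ∈ s ↔ y ∈ s) :
    s.indicator (1 : X → ℝ≥0∞) x = s.indicator 1 y := by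
  by_cases hy : y ∈ s
  · simp [hy, h.2 hy]
  · simp [hy, show x ∉ s from fun hx => hy (h.1 hx)]

/-- Write `μ` for the Haar measure of the general linear group, `ν` for that of `𝕋_p`, and `k` for
the indicator of the box. The double integral of `h(g) k(g⁻¹ L)` against `μ ⊗ ν` is evaluated in
both orders: one gives `ν(K) ∫ h dμ`, the other a multiple of `∫ h dν` whose factor does not involve
`h`. -/
lemma haarGeneralLinear_eq_mul_haarTriangular_aux {p : ℕ} : ∃ d : ℝ≥0∞,
    ∀ h : Mat p → ℝ≥0∞, Measurable h →
      (∀ X, ∀ A ∈ Matrix.orthogonalGroup (Fin p) ℝ, h (X * A) = h X) →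
      haarTriangular p (orthogonalBox p) * ∫⁻ X, h X ∂haarGeneralLinear p =
        d * ∫⁻ L, h L ∂haarTriangular p := by
  set K := orthogonalBox p
  have hK : MeasurableSet K := measurableSet_orthogonalBox p
  let k : Mat p → ℝ≥0∞ := K.indicator 1
  have hk : Measurable k := measurable_one.indicator hK
  have hkl : ∀ X, ∀ A ∈ Matrix.orthogonalGroup (Fin p) ℝ, k (A * X) = k X := by
    intro X A hA
    exact indicator_one_congr (mul_left_mem_orthogonalBox_iff hA)
  have hkr : ∀ X, ∀ A ∈ Matrix.orthogonalGroup (Fin p) ℝ, k (X * A) = k X := by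
    intro X A hA
    exact indicator_one_congr (mul_right_mem_orthogonalBox_iff hA)
  have hνK : ∫⁻ L, k L ∂haarTriangular p = haarTriangular p K := lintegral_indicator_one hK
  have h0 : haarTriangular p K ≠ 0 := haarTriangular_orthogonalBox_ne_zero p
  have htop : haarTriangular p K ≠ ∞ := haarTriangular_orthogonalBox_ne_top p
  -- The factor by which right translation by `g` scales `ν` on right orthogonally invariant
  -- functions, read off from the test function `k`; this formula makes it visibly measurable in
  -- `g`.
  let c : Mat p → ℝ≥0∞ := fun g => (∫⁻ L, k (L * g) ∂haarTriangular p) / haarTriangular p K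
  have hkmul : Measurable fun q : Mat p × Mat p => k (q.2 * q.1) :=
    hk.comp (measurable_matrix_mul.comp measurable_swap)
  have hcm : Measurable c := (Measurable.lintegral_prod_right' hkmul).div_const _
  have hc : ∀ g : Mat p, g.det ≠ 0 → ∀ h : Mat p → ℝ≥0∞, Measurable h →
      (∀ X, ∀ A ∈ Matrix.orthogonalGroup (Fin p) ℝ, h (X * A) = h X) →
      ∫⁻ L, h (L * g) ∂haarTriangular p = c g * ∫⁻ L, h L ∂haarTriangular p := by
    intro g hg h hh hinv
    obtain ⟨T, hT, A, hA, rfl⟩ := exists_posTriangular_mul_orthogonal hg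
    obtain ⟨c', hc'⟩ := exists_lintegral_haarTriangular_mul_right hT
    have h1 : c (T * A) = c' := by
      simp only [c, ← Matrix.mul_assoc, hkr _ A hA]
      rw [hc' k hk, hνK, ENNReal.mul_div_cancel_right h0 htop]
    simp only [h1, ← Matrix.mul_assoc, hinv _ A hA]
    exact hc' h hh
  refine ⟨∫⁻ g, k g⁻¹ * c g ∂haarGeneralLinear p, fun h hh hinv => ?_⟩
  have hkinv : Measurable fun g : Mat p => k g⁻¹ := hk.comp measurable_matrix_inv
  have hJm : Measurable fun q : Mat p × Mat p => h q.1 * k (q.1⁻¹ * q.2) :=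
    (hh.comp measurable_fst).mul (hk.comp (measurable_matrix_mul.comp
      ((measurable_matrix_inv.comp measurable_fst).prodMk measurable_snd)))
  -- For `g = T A`, left invariance of `k` removes `A'` and left invariance of `ν` removes `T⁻¹`.
  have way1 : ∫⁻ g, ∫⁻ L, h g * k (g⁻¹ * L) ∂haarTriangular p ∂haarGeneralLinear p =
      haarTriangular p K * ∫⁻ X, h X ∂haarGeneralLinear p := by
    rw [← lintegral_const_mul _ hh]
    refine lintegral_congr_ae ?_
    filter_upwards [ae_det_ne_zero_haarGeneralLinear p] with g hg
    obtain ⟨T, hT, A, hA, rfl⟩ := exists_posTriangular_mul_orthogonal hg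
    have h1 : ∀ L, k ((T * A)⁻¹ * L) = k (T⁻¹ * L) := by
      intro L
      rw [Matrix.mul_inv_rev, Matrix.mul_assoc, orthogonal_inv hA,
        hkl _ _ (transpose_mem_orthogonalGroup hA)]
    simp only [h1]
    rw [lintegral_const_mul _ (f := fun L => k (T⁻¹ * L)) (hk.comp (measurable_mul_left _)),
      lintegral_haarTriangular_mul_left (inv_mem_posTriangular hT) hk, hνK, mul_comm]
  have way2 : ∫⁻ L, ∫⁻ g, h g * k (g⁻¹ * L) ∂haarGeneralLinear p ∂haarTriangular p =
      (∫⁻ g, k g⁻¹ * c g ∂haarGeneralLinear p) * ∫⁻ L, h L ∂haarTriangular p := by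
    -- The substitution `g ↦ L g` moves `L` from `k` into `h`.
    have h1 : ∫⁻ L, ∫⁻ g, h g * k (g⁻¹ * L) ∂haarGeneralLinear p ∂haarTriangular p =
        ∫⁻ L, ∫⁻ g, k g⁻¹ * h (L * g) ∂haarGeneralLinear p ∂haarTriangular p := by
      refine lintegral_congr_ae ?_
      filter_upwards [ae_mem_posTriangular p] with L hL
      have hL0 := (det_pos_of_mem_posTriangular hL).ne'
      have hm : Measurable fun g => h g * k (g⁻¹ * L) :=
        hJm.comp (measurable_id.prodMk measurable_const)
      rw [← lintegral_haarGeneralLinear_mul_left hL0 hm]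
      refine lintegral_congr fun g => ?_
      rw [Matrix.mul_inv_rev, Matrix.mul_assoc, Matrix.nonsing_inv_mul L hL0.isUnit,
        Matrix.mul_one, mul_comm]
    have hm2 : Measurable fun q : Mat p × Mat p => k q.2⁻¹ * h (q.1 * q.2) :=
      (hkinv.comp measurable_snd).mul (hh.comp measurable_matrix_mul)
    rw [h1, lintegral_lintegral_swap hm2.aemeasurable, ← lintegral_mul_const _
      (f := fun g => k g⁻¹ * c g) (hkinv.mul hcm)]
    refine lintegral_congr_ae ?_
    filter_upwards [ae_det_ne_zero_haarGeneralLinear p] with g hg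
    rw [lintegral_const_mul _ (f := fun L => h (L * g)) (hh.comp (measurable_mul_right g)),
      hc g hg h hh hinv, mul_assoc]
  rw [← way1, ← way2]
  exact lintegral_lintegral_swap hJm.aemeasurable

/-- Testing on the indicator of the box identifies `d` as its Haar measure in the general linear
group, which is positive and finite, so `d` can be cancelled. -/
lemma exists_haarGeneralLinear_eq_mul_haarTriangular {p : ℕ} : ∃ d : ℝ≥0∞, d ≠ 0 ∧ d ≠ ∞ ∧
    ∀ h : Mat p → ℝ≥0∞, Measurable h →
      (∀ X, ∀ A ∈ Matrix.orthogonalGroup (Fin p) ℝ, h (X * A) = h X) →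
      haarTriangular p (orthogonalBox p) * ∫⁻ X, h X ∂haarGeneralLinear p =
        d * ∫⁻ L, h L ∂haarTriangular p := by
  obtain ⟨d, hd⟩ := haarGeneralLinear_eq_mul_haarTriangular_aux (p := p)
  have hK := measurableSet_orthogonalBox p
  have h1 := hd ((orthogonalBox p).indicator 1) (measurable_one.indicator hK) (by
    intro X A hA
    exact indicator_one_congr (mul_right_mem_orthogonalBox_iff hA))
  rw [lintegral_indicator_one hK, lintegral_indicator_one hK, mul_comm,
    ENNReal.mul_left_inj (haarTriangular_orthogonalBox_ne_zero p)
      (haarTriangular_orthogonalBox_ne_top p)] at h1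
  exact ⟨d, h1 ▸ haarGeneralLinear_orthogonalBox_ne_zero p,
    h1 ▸ haarGeneralLinear_orthogonalBox_ne_top p, hd⟩

/-- The Haar measure of `𝕋_p`, seen as a measure on the quotient of the general linear group by the
orthogonal group, is invariant under the general linear group. -/
lemma lintegral_haarTriangular_mul_left_of_orthogonal_invariant {p : ℕ} {S : Mat p}
    (hS : S.det ≠ 0) {h : Mat p → ℝ≥0∞} (hh : Measurable h)
    (hinv : ∀ X, ∀ A ∈ Matrix.orthogonalGroup (Fin p) ℝ, h (X * A) = h X) :
    ∫⁻ L, h (S * L) ∂haarTriangular p = ∫⁻ L, h L ∂haarTriangular p := by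
  obtain ⟨d, hd0, hdtop, hd⟩ := exists_haarGeneralLinear_eq_mul_haarTriangular (p := p)
  have h1 := hd h hh hinv
  have h2 := hd (fun X => h (S * X)) (hh.comp (measurable_mul_left S)) (by
    intro X A hA
    rw [← Matrix.mul_assoc, hinv _ A hA])
  rw [lintegral_haarGeneralLinear_mul_left hS hh, h1] at h2
  exact ((ENNReal.mul_right_inj hd0 hdtop).1 h2).symm

/-! ### Measurability in the space of measures -/

open Classical in
/-- The measure `F` itself if it is a probability measure, and the point mass at `0` otherwise. -/
noncomputable def toProbability {p : ℕ} (F : Measure (Vec p)) : Measure (Vec p) :=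
  if F Set.univ = 1 then F else Measure.dirac 0

lemma toProbability_eq_self {p : ℕ} (F : Measure (Vec p)) [IsProbabilityMeasure F] :
    toProbability F = F := if_pos measure_univ

instance isProbabilityMeasure_toProbability {p : ℕ} (F : Measure (Vec p)) :
    IsProbabilityMeasure (toProbability F) := by
  unfold toProbability
  split_ifs with h
  · exact ⟨h⟩
  · infer_instance

lemma measurableSet_isProbabilityMeasure (X : Type*) [MeasurableSpace X] :
    MeasurableSet {F : Measure X | IsProbabilityMeasure F} := by
  have h : {F : Measure X | IsProbabilityMeasure F} = (fun F => F Set.univ) ⁻¹' {1} := by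
    ext F
    exact isProbabilityMeasure_iff
  rw [h]
  exact Measure.measurable_coe MeasurableSet.univ (measurableSet_singleton 1)

lemma measurable_toProbability {p : ℕ} : Measurable (toProbability (p := p)) := by
  classical
  exact Measurable.ite
    (Measure.measurable_coe MeasurableSet.univ (measurableSet_singleton (1 : ℝ≥0∞)))
    measurable_id measurable_const

/-- The purpose of `toProbability`: it turns any measurable family of measures into a Markov kernel,
for which the masses of sections of measurable sets depend measurably on the parameter. Random
probability measures are almost surely unaffected. -/
lemma measurable_toProbability_prodMk {p : ℕ} {Ω : Type*} [MeasurableSpace Ω]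
    {f : Ω → Measure (Vec p)} (hf : Measurable f) {s : Set (Ω × Vec p)} (hs : MeasurableSet s) :
    Measurable fun ω => toProbability (f ω) (Prod.mk ω ⁻¹' s) := by
  let κ : Kernel Ω (Vec p) := ⟨fun ω => toProbability (f ω), measurable_toProbability.comp hf⟩
  have : IsMarkovKernel κ := ⟨fun ω => isProbabilityMeasure_toProbability (f ω)⟩
  exact Kernel.measurable_kernel_prodMk_left (κ := κ) hs

/-- Works because the default value is the point mass at `0`, which linear maps fix. -/
lemma toProbability_map_affineMap {p : ℕ} (S : Mat p) (F : Measure (Vec p)) :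
    toProbability (F.map (affineMap 0 S)) = (toProbability F).map (affineMap 0 S) := by
  have hm := measurable_affineMap 0 S
  unfold toProbability
  rw [Measure.map_apply hm MeasurableSet.univ, Set.preimage_univ]
  split_ifs
  · rfl
  · rw [Measure.map_dirac' hm]
    simp [affineMap]

/-- The location-scale transform, as a function of all its arguments. -/
noncomputable def scaledLaw {p : ℕ} (z : (Vec p × Mat p) × Measure (Vec p)) : Measure (Vec p) :=
  (toProbability z.2).map (affineMap z.1.1 z.1.2)

instance isProbabilityMeasure_scaledLaw {p : ℕ} (z : (Vec p × Mat p) × Measure (Vec p)) :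
    IsProbabilityMeasure (scaledLaw z) :=
  Measure.isProbabilityMeasure_map (measurable_affineMap _ _).aemeasurable

lemma measurable_scaledLaw {p : ℕ} : Measurable (scaledLaw (p := p)) := by
  refine Measure.measurable_of_measurable_coe _ fun B hB => ?_
  have hs : MeasurableSet {w : ((Vec p × Mat p) × Measure (Vec p)) × Vec p |
      affineMap w.1.1.1 w.1.1.2 w.2 ∈ B} :=
    (measurable_affineMap_uncurried.comp
      ((measurable_fst.comp measurable_fst).prodMk measurable_snd)) hB
  have h := measurable_toProbability_prodMk (f := fun z : (Vec p × Mat p) × Measure (Vec p) => z.2)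
    measurable_snd hs
  have heq : (fun z : (Vec p × Mat p) × Measure (Vec p) => scaledLaw z B) =
      fun z => toProbability z.2 (affineMap z.1.1 z.1.2 ⁻¹' B) := by
    ext1 z
    rw [scaledLaw, Measure.map_apply (measurable_affineMap _ _) hB]
  rw [heq]
  exact h

lemma measurable_density {p : ℕ} :
    Measurable fun w : Measure (Vec p) × Vec p => density (toProbability w.1) w.2 := by
  refine Measurable.limsup fun k => ?_
  have hs : MeasurableSet {w : (Measure (Vec p) × Vec p) × Vec p |
      dist w.2 w.1.2 ≤ 1 / ((k : ℝ) + 1)} :=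
    measurableSet_le (measurable_snd.dist (measurable_snd.comp measurable_fst)) measurable_const
  have h := measurable_toProbability_prodMk (f := fun z : Measure (Vec p) × Vec p => z.1)
    measurable_fst hs
  -- The volume of a ball does not depend on its centre, so the denominators are constants.
  simp only [Measure.addHaar_closedBall_center]
  exact h.div_const _

lemma measurable_density_comp {p : ℕ} {Ω : Type*} [MeasurableSpace Ω] {f : Ω → Measure (Vec p)}
    {g : Ω → Vec p} (hf : Measurable f) (hg : Measurable g) :
    Measurable fun ω => density (toProbability (f ω)) (g ω) := by
  have h := Measurable.comp measurable_density (hf.prodMk hg)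
  exact h

lemma measurable_prod_density {p n : ℕ} :
    Measurable fun w : Measure (Vec p) × (Fin n → Vec p) =>
      ∏ i, density (toProbability w.1) (w.2 i) := by
  refine Finset.measurable_prod _ fun i _ => ?_
  exact measurable_density_comp measurable_fst ((measurable_pi_apply i).comp measurable_snd)

lemma measurable_pi_toProbability {p n : ℕ} :
    Measurable fun F : Measure (Vec p) => Measure.pi fun _ : Fin n => toProbability F := by
  refine Measurable.measure_of_isPiSystem_of_isProbabilityMeasure generateFrom_pi.symm
    isPiSystem_pi ?_
  rintro _ ⟨s, hs, rfl⟩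
  simp only [Measure.pi_pi]
  exact Finset.measurable_prod _ fun i _ =>
    (Measure.measurable_coe (show MeasurableSet (s i) from hs i (Set.mem_univ i))).comp
      measurable_toProbability

/-! ### Lebesgue densities -/

/-- By Besicovitch differentiation the ratios converge almost everywhere, and the limsup is then the
limit. -/
lemma density_ae_eq_rnDeriv {p : ℕ} (F : Measure (Vec p)) [IsFiniteMeasure F] :
    density F =ᵐ[volume] F.rnDeriv volume := by
  filter_upwards [Besicovitch.ae_tendsto_rnDeriv F volume] with x hx
  have h : Tendsto (fun k : ℕ => 1 / ((k : ℝ) + 1)) atTop (nhdsWithin 0 (Set.Ioi 0)) := by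
    refine tendsto_nhdsWithin_iff.2 ⟨tendsto_one_div_add_atTop_nhds_zero_nat, ?_⟩
    exact Eventually.of_forall fun k => Set.mem_Ioi.2 Nat.one_div_pos_of_nat
  exact (hx.comp h).limsup_eq

lemma withDensity_density {p : ℕ} {F : Measure (Vec p)} [IsProbabilityMeasure F]
    (hF : F ≪ volume) : (volume : Measure (Vec p)).withDensity (density F) = F := by
  rw [withDensity_congr_ae (density_ae_eq_rnDeriv F), Measure.withDensity_rnDeriv_eq F volume hF]

lemma measurable_density_right {p : ℕ} (F : Measure (Vec p)) [IsProbabilityMeasure F] :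
    Measurable (density F) := by
  have h := measurable_density.comp (measurable_prodMk_left (x := F))
  simpa only [Function.comp_def, toProbability_eq_self] using h

lemma pi_eq_withDensity_density {p n : ℕ} {F : Measure (Vec p)} [IsProbabilityMeasure F]
    (hF : F ≪ volume) : Measure.pi (fun _ : Fin n => F) =
      (volume : Measure (Fin n → Vec p)).withDensity fun x => ∏ i, density F (x i) := by
  have : SigmaFinite ((volume : Measure (Vec p)).withDensity (density F)) := by
    rw [withDensity_density hF]; infer_instance
  have h := pi_withDensity (fun _ : Fin n => (volume : Measure (Vec p))) (fun _ => density F)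
    fun _ => measurable_density_right F
  rwa [withDensity_density hF] at h

lemma quasiMeasurePreserving_affineMap {p : ℕ} (a : Vec p) {S : Mat p} (hS : S.det ≠ 0) :
    Measure.QuasiMeasurePreserving (affineMap a S) volume volume :=
  ⟨measurable_affineMap a S,
    absolutelyContinuous_map_affineMap a hS Measure.AbsolutelyContinuous.rfl⟩

/-- Linear maps send balls to ellipsoids, so equivariance of the chosen version is only claimed
almost everywhere: both sides are versions of the same Radon–Nikodym derivative. -/
lemma density_map_affineMap {p : ℕ} {S : Mat p} (hS : S.det ≠ 0) {F : Measure (Vec p)}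
    [IsProbabilityMeasure F] (hF : F ≪ volume) :
    ∀ᵐ y, density (F.map (affineMap 0 S)) (affineMap 0 S y) =
      ENNReal.ofReal |S.det|⁻¹ * density F y := by
  have hm := measurable_affineMap 0 S
  have hmi := measurable_affineMap 0 S⁻¹
  have hd := measurable_density_right F
  have : IsProbabilityMeasure (F.map (affineMap 0 S)) :=
    Measure.isProbabilityMeasure_map hm.aemeasurable
  have hg : Measurable fun y => ENNReal.ofReal |S.det|⁻¹ * density F (affineMap 0 S⁻¹ y) :=
    (hd.comp hmi).const_mul _
  have h1 : F.map (affineMap 0 S) = (volume : Measure (Vec p)).withDensity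
      fun y => ENNReal.ofReal |S.det|⁻¹ * density F (affineMap 0 S⁻¹ y) := by
    ext B hB
    rw [Measure.map_apply hm hB, withDensity_apply _ hB]
    conv_lhs => rw [← withDensity_density hF]
    rw [withDensity_apply _ (hm hB),
      lintegral_const_mul _ (f := fun y => density F (affineMap 0 S⁻¹ y)) (hd.comp hmi),
      ← smul_eq_mul, ← lintegral_smul_measure, ← Measure.restrict_smul,
      ← map_affineMap_volume 0 hS, setLIntegral_map (f := fun y => density F (affineMap 0 S⁻¹ y)) hB
        (hd.comp hmi) hm]
    simp only [affineMap_inv_affineMap hS]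
  have h2 : density (F.map (affineMap 0 S)) =ᵐ[volume]
      fun y => ENNReal.ofReal |S.det|⁻¹ * density F (affineMap 0 S⁻¹ y) := by
    refine (density_ae_eq_rnDeriv _).trans ?_
    conv_lhs => rw [h1]
    exact Measure.rnDeriv_withDensity _ hg
  filter_upwards [(quasiMeasurePreserving_affineMap 0 hS).ae h2] with y hy
  rw [hy, affineMap_inv_affineMap hS]

/-- Unlike the linear case this is exact at every point, since translations carry balls to balls of
the same volume. -/
lemma density_map_affineMap_location {p : ℕ} (m : Vec p) (S : Mat p) (F : Measure (Vec p))
    (x : Vec p) :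
    density (F.map (affineMap m S)) x = density (F.map (affineMap 0 S)) (x - m) := by
  unfold density
  congr 1
  ext1 k
  rw [Measure.map_apply (measurable_affineMap _ _) measurableSet_closedBall,
    Measure.map_apply (measurable_affineMap _ _) measurableSet_closedBall,
    Measure.addHaar_closedBall_center, Measure.addHaar_closedBall_center _ (x - m)]
  congr 2
  ext z
  simp only [Set.mem_preimage, Metric.mem_closedBall, affineMap, dist_eq_norm, zero_add]
  rw [show m + (Matrix.toEuclideanCLM (𝕜 := ℝ) S) z - x =
    (Matrix.toEuclideanCLM (𝕜 := ℝ) S) z - (x - m) by abel]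

/-- The likelihood of the location family of `F`, integrated over the location. -/
noncomputable def locationLikelihood {p n : ℕ} (F : Measure (Vec p)) (x : Fin n → Vec p) : ℝ≥0∞ :=
  ∫⁻ m, ∏ i, density F (x i - m)

lemma locationLikelihood_add {p n : ℕ} (F : Measure (Vec p)) (a : Vec p) (x : Fin n → Vec p) :
    locationLikelihood F (fun i => a + x i) = locationLikelihood F x := by
  unfold locationLikelihood
  rw [← lintegral_add_left_eq_self _ a]
  simp only [add_sub_add_left_eq_sub]

lemma lintegral_comp_affineMap {p : ℕ} {S : Mat p} (hS : S.det ≠ 0) {f : Vec p → ℝ≥0∞}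
    (hf : Measurable f) :
    ∫⁻ m, f m = ENNReal.ofReal |S.det| * ∫⁻ m, f (affineMap 0 S m) := by
  rw [← lintegral_map hf (measurable_affineMap 0 S), map_affineMap_volume 0 hS,
    lintegral_smul_measure, smul_eq_mul, ← mul_assoc, ← ENNReal.ofReal_mul (abs_nonneg _),
    mul_inv_cancel₀ (abs_ne_zero.2 hS), ENNReal.ofReal_one, one_mul]

/-- The `n` densities contribute `|det S|⁻ⁿ` and the substitution `m ↦ S m` contributes `|det S|`.
-/
lemma locationLikelihood_map_affineMap {p n : ℕ} {S : Mat p} (hS : S.det ≠ 0)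
    {F : Measure (Vec p)} [IsProbabilityMeasure F] (hF : F ≪ volume) (x : Fin n → Vec p) :
    locationLikelihood (F.map (affineMap 0 S)) (fun i => affineMap 0 S (x i)) =
      ENNReal.ofReal (|S.det| ^ (-((n : ℤ) - 1))) * locationLikelihood F x := by
  have : IsProbabilityMeasure (F.map (affineMap 0 S)) :=
    Measure.isProbabilityMeasure_map (measurable_affineMap 0 S).aemeasurable
  have hm : ∀ (G : Measure (Vec p)) [IsProbabilityMeasure G] (y : Fin n → Vec p),
      Measurable fun m => ∏ i, density G (y i - m) := fun G _ y =>
    Finset.measurable_prod _ fun i _ =>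
      (measurable_density_right G).comp (measurable_const.sub measurable_id)
  have hpos : 0 < |S.det| := abs_pos.2 hS
  unfold locationLikelihood
  rw [lintegral_comp_affineMap hS (hm _ _), ← lintegral_const_mul' _ _ ENNReal.ofReal_ne_top,
    ← lintegral_const_mul' _ _ ENNReal.ofReal_ne_top]
  refine lintegral_congr_ae ?_
  -- For fixed `x`, the map `m ↦ x i - m` pulls null sets back to null sets, so the exceptional set
  -- of the density rule is invisible to the integral over `m`.
  have h : ∀ᵐ m : Vec p, ∀ i, density (F.map (affineMap 0 S)) (affineMap 0 S (x i - m)) =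
      ENNReal.ofReal |S.det|⁻¹ * density F (x i - m) := by
    rw [ae_all_iff]
    intro i
    exact (quasiMeasurePreserving_sub_left volume (x i)).ae (density_map_affineMap hS hF)
  filter_upwards [h] with m hmi
  have hlin : ∀ i, affineMap 0 S (x i) - affineMap 0 S m = affineMap 0 S (x i - m) := by
    intro i
    simp [affineMap]
  simp only [hlin, hmi, Finset.prod_mul_distrib, Finset.prod_const, Finset.card_univ,
    Fintype.card_fin]
  rw [← mul_assoc, ← ENNReal.ofReal_pow (inv_nonneg.2 hpos.le), ← ENNReal.ofReal_mul hpos.le]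
  congr 2
  rw [inv_pow, ← zpow_natCast, ← zpow_neg, neg_sub, sub_eq_add_neg, zpow_add₀ hpos.ne', zpow_one]

/-! ### Marginal likelihoods of location-scale families -/

lemma ae_haarPrior_mem_posTriangular (p : ℕ) : ∀ᵐ q ∂haarPrior p, q.2 ∈ posTriangular p :=
  Measure.quasiMeasurePreserving_snd.ae (ae_mem_posTriangular p)

instance instSFiniteHaarPrior (p : ℕ) : SFinite (haarPrior p) := by
  rw [haarPrior_eq_prod]
  infer_instance

/-- A sample from the mixture is a transform of an independent pair of a parameter and `F⋆`. The
family is prescribed only over `𝕋_p`, which carries the whole prior, so it can be replaced by a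
measurable version. -/
lemma haarMixture_eq_map {p : ℕ} {Fam : Vec p → Mat p → Measure (Measure (Vec p))}
    {Q : Measure (Measure (Vec p))} (h : IsLocationScaleFamily Fam Q) :
    haarMixture Fam = ((haarPrior p).prod Q).map scaledLaw := by
  have := h.law.isProbabilityMeasure
  have hmap : Measurable fun q : Vec p × Mat p => Q.map fun F => scaledLaw (q, F) :=
    measurable_map_of_measurable_uncurried Q measurable_scaledLaw
  have h1 : haarMixture Fam = (haarPrior p).bind fun q => Q.map fun F => scaledLaw (q, F) := by
    refine Measure.bind_congr_right ?_
    filter_upwards [ae_haarPrior_mem_posTriangular p] with q hq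
    rw [h.eq_map q.1 q.2 hq]
    refine Measure.map_congr ?_
    filter_upwards [h.law.ae_isProbabilityMeasure] with F hF
    rw [scaledLaw, toProbability_eq_self, locationScale]
  rw [h1]
  ext B hB
  rw [Measure.bind_apply hB hmap.aemeasurable, Measure.map_apply measurable_scaledLaw hB,
    Measure.prod_apply (measurable_scaledLaw hB)]
  refine lintegral_congr fun q => ?_
  rw [Measure.map_apply (f := fun F => scaledLaw (q, F))
    (measurable_scaledLaw.comp measurable_prodMk_left) hB]
  rfl

lemma ae_isProbabilityMeasure_map_scaledLaw {p : ℕ}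
    (ρ : Measure ((Vec p × Mat p) × Measure (Vec p))) :
    ∀ᵐ F ∂(ρ.map scaledLaw), IsProbabilityMeasure F := by
  rw [ae_map_iff measurable_scaledLaw.aemeasurable (measurableSet_isProbabilityMeasure _)]
  exact Eventually.of_forall fun z => isProbabilityMeasure_scaledLaw z

lemma measurable_prod_density_scaledLaw {p n : ℕ} :
    Measurable fun w : ((Vec p × Mat p) × Measure (Vec p)) × (Fin n → Vec p) =>
      ∏ i, density (scaledLaw w.1) (w.2 i) := by
  have h := Measurable.comp (measurable_prod_density (p := p) (n := n))
    ((measurable_scaledLaw.comp measurable_fst).prodMk measurable_snd :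
      Measurable fun w : ((Vec p × Mat p) × Measure (Vec p)) × (Fin n → Vec p) =>
        (scaledLaw w.1, w.2))
  simpa only [Function.comp_def, toProbability_eq_self] using h

lemma marginalLikelihood_map_scaledLaw {p n : ℕ}
    (ρ : Measure ((Vec p × Mat p) × Measure (Vec p))) (x : Fin n → Vec p) :
    marginalLikelihood (ρ.map scaledLaw) n x = ∫⁻ z, ∏ i, density (scaledLaw z) (x i) ∂ρ := by
  have hm : Measurable fun F : Measure (Vec p) => ∏ i, density (toProbability F) (x i) := by
    have h := Measurable.comp (measurable_prod_density (p := p) (n := n))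
      (measurable_prodMk_right (y := x))
    exact h
  -- Inserting `toProbability` changes nothing almost surely and makes the integrand measurable, as
  -- the change of variables needs.
  have h1 : marginalLikelihood (ρ.map scaledLaw) n x =
      ∫⁻ F, ∏ i, density (toProbability F) (x i) ∂(ρ.map scaledLaw) := by
    refine lintegral_congr_ae ?_
    filter_upwards [ae_isProbabilityMeasure_map_scaledLaw ρ] with F hF
    rw [toProbability_eq_self]
  rw [h1, lintegral_map hm measurable_scaledLaw]
  simp only [toProbability_eq_self]

lemma scaledLaw_absolutelyContinuous {p : ℕ} {z : (Vec p × Mat p) × Measure (Vec p)}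
    (hL : z.1.2.det ≠ 0) [IsProbabilityMeasure z.2] (hF : z.2 ≪ volume) :
    scaledLaw z ≪ volume := by
  rw [scaledLaw, toProbability_eq_self]
  exact absolutelyContinuous_map_affineMap _ hL hF

/-- For almost every parameter and `F⋆`, the `n`-fold product has the product density; Tonelli then
exchanges the integral over the sample with the one over the prior and `Q`. -/
lemma predictive_haarMixture {p n : ℕ} {Fam : Vec p → Mat p → Measure (Measure (Vec p))}
    {Q : Measure (Measure (Vec p))} (h : IsLocationScaleFamily Fam Q)
    (hac : IsAbsolutelyContinuousLaw Q) :
    predictive (haarMixture Fam) n = (volume : Measure (Fin n → Vec p)).withDensity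
      (marginalLikelihood (haarMixture Fam) n) := by
  have := h.law.isProbabilityMeasure
  rw [haarMixture_eq_map h]
  set ρ := (haarPrior p).prod Q with hρ
  have hpi : Measurable fun F : Measure (Vec p) => Measure.pi fun _ : Fin n => toProbability F :=
    measurable_pi_toProbability
  have h1 : predictive (ρ.map scaledLaw) n =
      (ρ.map scaledLaw).bind fun F => Measure.pi fun _ : Fin n => toProbability F := by
    refine Measure.bind_congr_right ?_
    filter_upwards [ae_isProbabilityMeasure_map_scaledLaw ρ] with F hF
    rw [toProbability_eq_self]
  have hac' : ∀ᵐ z ∂ρ, scaledLaw z ≪ volume := by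
    have hq : ∀ᵐ z ∂ρ, z.1.2 ∈ posTriangular p :=
      Measure.quasiMeasurePreserving_fst.ae (ae_haarPrior_mem_posTriangular p)
    have hF1 : ∀ᵐ z ∂ρ, IsProbabilityMeasure z.2 :=
      Measure.quasiMeasurePreserving_snd.ae h.law.ae_isProbabilityMeasure
    have hF2 : ∀ᵐ z ∂ρ, z.2 ≪ (volume : Measure (Vec p)) :=
      Measure.quasiMeasurePreserving_snd.ae hac
    filter_upwards [hq, hF1, hF2] with z h1 h2 h3
    exact scaledLaw_absolutelyContinuous (det_pos_of_mem_posTriangular h1).ne' h3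
  rw [h1]
  ext B hB
  have hcoe : Measurable fun F : Measure (Vec p) =>
      (Measure.pi fun _ : Fin n => toProbability F) B := (Measure.measurable_coe hB).comp hpi
  rw [Measure.bind_apply hB hpi.aemeasurable, lintegral_map hcoe measurable_scaledLaw,
    withDensity_apply _ hB]
  simp only [toProbability_eq_self, marginalLikelihood_map_scaledLaw]
  rw [lintegral_lintegral_swap (f := fun (x : Fin n → Vec p) z =>
    ∏ i, density (scaledLaw z) (x i))
    (measurable_prod_density_scaledLaw.comp measurable_swap).aemeasurable]
  refine lintegral_congr_ae ?_
  filter_upwards [hac'] with z hz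
  rw [pi_eq_withDensity_density hz, withDensity_apply _ hB]

/-- The likelihood of the location family of the image of `F⋆` under `L`, integrated over the
location and over the law `Q` of `F⋆`. -/
noncomputable def scaleLikelihood {p n : ℕ} (Q : Measure (Measure (Vec p))) (L : Mat p)
    (x : Fin n → Vec p) : ℝ≥0∞ :=
  ∫⁻ F, locationLikelihood (scaledLaw ((0, L), F)) x ∂Q

lemma density_scaledLaw {p : ℕ} (m : Vec p) (L : Mat p) (F : Measure (Vec p)) (x : Vec p) :
    density (scaledLaw ((m, L), F)) x = density (scaledLaw ((0, L), F)) (x - m) :=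
  density_map_affineMap_location m L _ x

lemma measurable_locationLikelihood_scaledLaw {p n : ℕ} (x : Fin n → Vec p) :
    Measurable fun w : Mat p × Measure (Vec p) =>
      locationLikelihood (scaledLaw ((0, w.1), w.2)) x := by
  have hz : Measurable fun v : (Mat p × Measure (Vec p)) × Vec p =>
      ((((v.2, v.1.1), v.1.2), x) :
        ((Vec p × Mat p) × Measure (Vec p)) × (Fin n → Vec p)) :=
    ((measurable_snd.prodMk (measurable_fst.comp measurable_fst)).prodMk
      (measurable_snd.comp measurable_fst)).prodMk measurable_const
  have h := Measurable.comp (measurable_prod_density_scaledLaw (p := p) (n := n)) hz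
  have heq : ∀ v : (Mat p × Measure (Vec p)) × Vec p,
      ∏ i, density (scaledLaw ((v.2, v.1.1), v.1.2)) (x i) =
        ∏ i, density (scaledLaw ((0, v.1.1), v.1.2)) (x i - v.2) :=
    fun v => Finset.prod_congr rfl fun i _ => density_scaledLaw _ _ _ _
  simp only [Function.comp_def, heq] at h
  exact h.lintegral_prod_right'

lemma measurable_scaleLikelihood {p n : ℕ} (Q : Measure (Measure (Vec p))) [SFinite Q]
    (x : Fin n → Vec p) : Measurable fun L : Mat p => scaleLikelihood Q L x :=
  (measurable_locationLikelihood_scaledLaw x).lintegral_prod_right'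

/-- The density of the law located at `m` is a translate of the density located at `0`, so
integrating over `m` first yields the location likelihood. -/
lemma marginalLikelihood_haarMixture {p n : ℕ}
    {Fam : Vec p → Mat p → Measure (Measure (Vec p))} {Q : Measure (Measure (Vec p))}
    (h : IsLocationScaleFamily Fam Q) (x : Fin n → Vec p) :
    marginalLikelihood (haarMixture Fam) n x = ∫⁻ L, scaleLikelihood Q L x ∂haarTriangular p := by
  have := h.law.isProbabilityMeasure
  have hz : Measurable fun z : (Vec p × Mat p) × Measure (Vec p) =>
      ∏ i, density (scaledLaw z) (x i) := by
    have h := Measurable.comp (measurable_prod_density_scaledLaw (p := p) (n := n))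
      (measurable_prodMk_right (y := x))
    exact h
  have hq : Measurable fun q : Vec p × Mat p =>
      ∫⁻ F, ∏ i, density (scaledLaw (q, F)) (x i) ∂Q := hz.lintegral_prod_right'
  rw [haarMixture_eq_map h, marginalLikelihood_map_scaledLaw, lintegral_prod _ hz.aemeasurable,
    haarPrior_eq_prod, lintegral_prod_symm _ hq.aemeasurable]
  refine lintegral_congr fun L => ?_
  have hsw : Measurable fun w : Vec p × Measure (Vec p) =>
      ∏ i, density (scaledLaw ((w.1, L), w.2)) (x i) := by
    have h := Measurable.comp hz (((measurable_fst.prodMk measurable_const).prodMk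
      measurable_snd) : Measurable fun w : Vec p × Measure (Vec p) => ((w.1, L), w.2))
    exact h
  rw [lintegral_lintegral_swap (f := fun (m : Vec p) (F : Measure (Vec p)) =>
    ∏ i, density (scaledLaw ((m, L), F)) (x i)) hsw.aemeasurable]
  exact lintegral_congr fun F => lintegral_congr fun m =>
    Finset.prod_congr rfl fun i _ => density_scaledLaw _ _ _ _

lemma scaledLaw_mul {p : ℕ} (S L : Mat p) (F : Measure (Vec p)) :
    scaledLaw ((0, S * L), F) = (scaledLaw ((0, L), F)).map (affineMap 0 S) := by
  rw [scaledLaw, scaledLaw, Measure.map_map (measurable_affineMap _ _) (measurable_affineMap _ _)]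
  congr 1
  ext1 x
  simp only [Function.comp_apply, affineMap_comp]
  simp [affineMap]

/-- Transforming `F⋆` by `L A` is transforming its rotation by `L`, and the rotation has the same
law. -/
lemma scaleLikelihood_mul_orthogonal {p n : ℕ} {Q : Measure (Measure (Vec p))}
    (hrot : IsRotationInvariantLaw Q) (x : Fin n → Vec p) (L : Mat p) {A : Mat p}
    (hA : A ∈ Matrix.orthogonalGroup (Fin p) ℝ) :
    scaleLikelihood Q (L * A) x = scaleLikelihood Q L x := by
  have hQ : Q.map (locationScale 0 A) = Q := by
    simpa using hrot A.transpose (transpose_mem_orthogonalGroup hA)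
  have hm : Measurable fun F : Measure (Vec p) =>
      locationLikelihood (scaledLaw ((0, L), F)) x := by
    have h := Measurable.comp (measurable_locationLikelihood_scaledLaw x)
      (measurable_prodMk_left (x := L))
    exact h
  have hloc : Measurable (locationScale (p := p) 0 A) :=
    Measure.measurable_map _ (measurable_affineMap 0 A)
  unfold scaleLikelihood
  conv_rhs => rw [← hQ]
  rw [lintegral_map hm hloc]
  refine lintegral_congr fun F => ?_
  congr 1
  rw [scaledLaw_mul]
  simp only [scaledLaw, locationScale, toProbability_map_affineMap]

lemma scaleLikelihood_mul_affineMap {p n : ℕ} {Q : Measure (Measure (Vec p))}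
    (hQ : IsRandomProbabilityLaw Q) (hac : IsAbsolutelyContinuousLaw Q) {S L : Mat p}
    (hS : S.det ≠ 0) (hL : L.det ≠ 0) (x : Fin n → Vec p) :
    scaleLikelihood Q (S * L) (fun i => affineMap 0 S (x i)) =
      ENNReal.ofReal (|S.det| ^ (-((n : ℤ) - 1))) * scaleLikelihood Q L x := by
  unfold scaleLikelihood
  rw [← lintegral_const_mul' _ _ ENNReal.ofReal_ne_top]
  refine lintegral_congr_ae ?_
  filter_upwards [hQ.ae_isProbabilityMeasure, hac] with F hF1 hF2
  rw [scaledLaw_mul]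
  exact locationLikelihood_map_affineMap hS
    (scaledLaw_absolutelyContinuous (z := ((0, L), F)) hL hF2) x

lemma marginalLikelihood_haarMixture_affineMap {p n : ℕ}
    {Fam : Vec p → Mat p → Measure (Measure (Vec p))} {Q : Measure (Measure (Vec p))}
    (h : IsLocationScaleFamily Fam Q) (hac : IsAbsolutelyContinuousLaw Q)
    (hrot : IsRotationInvariantLaw Q) (a : Vec p) {S : Mat p} (hS : S.det ≠ 0)
    (x : Fin n → Vec p) :
    marginalLikelihood (haarMixture Fam) n (fun i => affineMap a S (x i)) =
      ENNReal.ofReal (|S.det| ^ (-((n : ℤ) - 1))) * marginalLikelihood (haarMixture Fam) n x := by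
  have := h.law.isProbabilityMeasure
  have hadd : ∀ i, affineMap a S (x i) = a + affineMap 0 S (x i) := by
    intro i
    simp [affineMap]
  have hSi : S⁻¹.det ≠ 0 := by
    rw [Matrix.det_nonsing_inv, Ring.inverse_eq_inv']
    exact inv_ne_zero hS
  -- On the right-hand side `L` becomes `S⁻¹ L`; scaling by `S` then restores `L` and pairs it with
  -- the transformed data.
  rw [marginalLikelihood_haarMixture h, marginalLikelihood_haarMixture h,
    ← lintegral_haarTriangular_mul_left_of_orthogonal_invariant hSi
      (measurable_scaleLikelihood Q x) fun L A hA => scaleLikelihood_mul_orthogonal hrot x L hA,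
    ← lintegral_const_mul' _ _ ENNReal.ofReal_ne_top]
  refine lintegral_congr_ae ?_
  filter_upwards [ae_mem_posTriangular p] with L hL
  have hSL : (S⁻¹ * L).det ≠ 0 := by
    rw [Matrix.det_mul]
    exact mul_ne_zero hSi (det_pos_of_mem_posTriangular hL).ne'
  rw [← scaleLikelihood_mul_affineMap h.law hac hS hSL, ← Matrix.mul_assoc,
    Matrix.mul_nonsing_inv S hS.isUnit, Matrix.one_mul]
  unfold scaleLikelihood
  simp only [hadd, locationLikelihood_add]

/-! ### The normal model -/

lemma stdGaussian_map_orthogonal {p : ℕ} {A : Mat p}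
    (hA : A ∈ Matrix.orthogonalGroup (Fin p) ℝ) :
    (stdGaussian (Vec p)).map (affineMap 0 A) = stdGaussian (Vec p) := by
  rw [← multivariateGaussian_mul_transpose 0 (orthogonal_det_ne_zero hA),
    orthogonal_mul_transpose hA, multivariateGaussian_zero_one]

lemma measurable_locationScale {p : ℕ} (m : Vec p) (S : Mat p) : Measurable (locationScale m S) :=
  Measure.measurable_map _ (measurable_affineMap m S)

lemma isLocationScaleFamily_normalFamily (p : ℕ) :
    IsLocationScaleFamily (normalFamily p) (Measure.dirac (stdGaussian (Vec p))) where
  law := by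
    refine ⟨inferInstance, ?_⟩
    rw [ae_dirac_iff (measurableSet_isProbabilityMeasure _)]
    infer_instance
  eq_map m L hL := by
    rw [normalFamily, multivariateGaussian_mul_transpose m (det_pos_of_mem_posTriangular hL).ne',
      Measure.map_dirac' (measurable_locationScale m L)]
    rfl

lemma isRotationInvariantLaw_dirac_stdGaussian (p : ℕ) :
    IsRotationInvariantLaw (Measure.dirac (stdGaussian (Vec p))) := by
  intro A hA
  rw [Measure.map_dirac' (measurable_locationScale _ _), locationScale,
    stdGaussian_map_orthogonal (transpose_mem_orthogonalGroup hA)]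

/-- The density is a version of the derivative of the absolutely continuous part, so a probability
measure is absolutely continuous exactly when its density integrates to `1`, a measurable condition.
It is needed to transfer almost sure statements through point masses and image laws. -/
lemma measurableSet_isProbabilityMeasure_absolutelyContinuous (p : ℕ) :
    MeasurableSet {F : Measure (Vec p) | IsProbabilityMeasure F ∧ F ≪ volume} := by
  have h : {F : Measure (Vec p) | IsProbabilityMeasure F ∧ F ≪ volume} =
      {F | IsProbabilityMeasure F} ∩
        (fun F => ∫⁻ x, density (toProbability F) x) ⁻¹' {1} := by
    ext F
    refine and_congr_right fun hF => ?_
    rw [Set.mem_preimage, Set.mem_singleton_iff, toProbability_eq_self]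
    constructor
    · intro hac
      have h1 := congrArg (fun G : Measure (Vec p) => G Set.univ) (withDensity_density hac)
      simpa using h1
    · intro h1
      rw [lintegral_congr_ae (density_ae_eq_rnDeriv F), ← setLIntegral_univ,
        ← withDensity_apply _ MeasurableSet.univ] at h1
      have h2 : (volume : Measure (Vec p)).withDensity (F.rnDeriv volume) = F := by
        have : IsFiniteMeasure ((volume : Measure (Vec p)).withDensity (F.rnDeriv volume)) :=
          ⟨by rw [h1]; exact ENNReal.one_lt_top⟩
        exact Measure.eq_of_le_of_measure_univ_eq (Measure.withDensity_rnDeriv_le F volume)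
          (by rw [h1, measure_univ])
      rw [← h2]
      exact withDensity_absolutelyContinuous _ _
  rw [h]
  refine (measurableSet_isProbabilityMeasure _).inter ?_
  exact (measurable_density.lintegral_prod_right') (measurableSet_singleton 1)

lemma isAbsolutelyContinuousLaw_dirac_stdGaussian (p : ℕ) :
    IsAbsolutelyContinuousLaw (Measure.dirac (stdGaussian (Vec p))) := by
  have h : ∀ᵐ F ∂(Measure.dirac (stdGaussian (Vec p))),
      IsProbabilityMeasure F ∧ F ≪ (volume : Measure (Vec p)) := by
    rw [ae_dirac_iff (measurableSet_isProbabilityMeasure_absolutelyContinuous p)]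
    exact ⟨inferInstance, stdGaussian_absolutelyContinuous p⟩
  exact h.mono fun F hF => hF.2

/-- Numerator and denominator acquire the same factor, which is neither `0` nor `∞` and so cancels
even when a marginal likelihood is `0` or `∞`. -/
lemma bayesFactor_affineMap {p n : ℕ} {Fam : Vec p → Mat p → Measure (Measure (Vec p))}
    {Q : Measure (Measure (Vec p))} (h : IsLocationScaleFamily Fam Q)
    (hac : IsAbsolutelyContinuousLaw Q) (hrot : IsRotationInvariantLaw Q) (a : Vec p) {S : Mat p}
    (hS : S.det ≠ 0) (x : Fin n → Vec p) :
    bayesFactor (normalFamily p) Fam n (fun i => affineMap a S (x i)) =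
      bayesFactor (normalFamily p) Fam n x := by
  unfold bayesFactor
  rw [marginalLikelihood_haarMixture_affineMap h hac hrot a hS,
    marginalLikelihood_haarMixture_affineMap (isLocationScaleFamily_normalFamily p)
      (isAbsolutelyContinuousLaw_dirac_stdGaussian p)
      (isRotationInvariantLaw_dirac_stdGaussian p) a hS]
  refine ENNReal.mul_div_mul_left _ _ ?_ ENNReal.ofReal_ne_top
  rw [Ne, ENNReal.ofReal_eq_zero, not_le]
  exact zpow_pos (abs_pos.2 hS) _

/-! ### Dirichlet processes -/

lemma map_bind {X Y Z : Type*} [MeasurableSpace X] [MeasurableSpace Y] [MeasurableSpace Z]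
    (m : Measure X) {f : X → Measure Y} (hf : Measurable f) {g : Y → Z} (hg : Measurable g) :
    (m.bind f).map g = m.bind fun x => (f x).map g := by
  ext B hB
  rw [Measure.map_apply hg hB, Measure.bind_apply (hg hB) hf.aemeasurable,
    Measure.bind_apply (f := fun x => (f x).map g) hB
      ((Measure.measurable_map g hg).comp hf).aemeasurable]
  exact lintegral_congr fun x => (Measure.map_apply hg hB).symm

lemma bind_map {X Y Z : Type*} [MeasurableSpace X] [MeasurableSpace Y] [MeasurableSpace Z]
    (m : Measure X) {c : X → Y} (hc : Measurable c) {f : Y → Measure Z} (hf : Measurable f) :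
    (m.map c).bind f = m.bind fun x => f (c x) := by
  ext B hB
  rw [Measure.bind_apply hB hf.aemeasurable,
    Measure.bind_apply (f := fun x => f (c x)) hB (hf.comp hc).aemeasurable]
  exact lintegral_map ((Measure.measurable_coe hB).comp hf) hc

/-- The evaluations generate the sigma-algebra on measures, so each measurable set of measures is a
preimage under the map collecting all evaluations. -/
lemma ext_of_map_coe {X : Type*} [MeasurableSpace X] {D₁ D₂ : Measure (Measure X)}
    (h : D₁.map (fun (ψ : Measure X) (s : {s : Set X // MeasurableSet s}) => ψ s) =
      D₂.map (fun (ψ : Measure X) (s : {s : Set X // MeasurableSet s}) => ψ s)) : D₁ = D₂ := by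
  let e : Measure X → {s : Set X // MeasurableSet s} → ℝ≥0∞ := fun ψ s => ψ s
  have he : Measurable e := measurable_pi_iff.2 fun s => Measure.measurable_coe s.2
  have hid : @Measurable _ _ (MeasurableSpace.comap e inferInstance) _
      (id : Measure X → Measure X) :=
    @Measure.measurable_of_measurable_coe X (Measure X) _ (MeasurableSpace.comap e inferInstance) id
      fun s hs => (measurable_pi_apply (⟨s, hs⟩ : {s : Set X // MeasurableSet s})).comp
        (comap_measurable e)
  ext T hT
  obtain ⟨T', hT', hTT⟩ := hid hT
  obtain rfl : e ⁻¹' T' = T := hTT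
  change D₁.map e = D₂.map e at h
  have h1 := congrArg (fun m => m T') h
  simpa only [Measure.map_apply he hT'] using h1

/-- The cells of the partition generated by a finite family of sets. -/
def partitionCell {X J : Type*} (s : J → Set X) (c : J → Bool) : Set X :=
  {x | ∀ j, x ∈ s j ↔ c j = true}

section PartitionCell

variable {X J : Type*} {s : J → Set X}

lemma measurableSet_partitionCell [MeasurableSpace X] [Finite J] (hs : ∀ j, MeasurableSet (s j))
    (c : J → Bool) : MeasurableSet (partitionCell s c) := by
  have h : partitionCell s c = ⋂ j, {x | x ∈ s j ↔ c j = true} := by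
    ext x
    simp [partitionCell]
  rw [h]
  refine MeasurableSet.iInter fun j => ?_
  cases hc : c j
  · have h : {x | x ∈ s j ↔ false = true} = (s j)ᶜ := by
      ext x
      simp
    rw [h]
    exact (hs j).compl
  · have h : {x | x ∈ s j ↔ true = true} = s j := by
      ext x
      simp
    rw [h]
    exact hs j

lemma pairwise_disjoint_partitionCell : Pairwise (Function.onFun Disjoint (partitionCell s)) := by
  intro c d hcd
  refine Set.disjoint_left.2 fun x hx hy => hcd (funext fun j => ?_)
  have h := (hx j).symm.trans (hy j)
  cases hc : c j <;> cases hd : d j <;> simp_all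

lemma exists_mem_partitionCell (x : X) : ∃ c, x ∈ partitionCell s c := by
  classical
  exact ⟨fun j => decide (x ∈ s j), fun j => by simp⟩

lemma measure_eq_sum_partitionCell [MeasurableSpace X] [Fintype J] [DecidableEq J]
    (hs : ∀ j, MeasurableSet (s j)) (ψ : Measure X) (j : J) :
    ψ (s j) = ∑ c : J → Bool, if c j = true then ψ (partitionCell s c) else 0 := by
  rw [← Finset.sum_filter, ← measure_biUnion_finset
    (fun c _ d _ hcd => pairwise_disjoint_partitionCell hcd)
    (fun c _ => measurableSet_partitionCell hs c)]
  congr 1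
  ext x
  simp only [Finset.mem_filter, Finset.mem_univ, true_and, Set.mem_iUnion, exists_prop]
  constructor
  · intro hx
    obtain ⟨c, hc⟩ := exists_mem_partitionCell (s := s) x
    exact ⟨c, (hc j).1 hx, hc⟩
  · rintro ⟨c, hcj, hc⟩
    exact (hc j).2 hcj

end PartitionCell

instance isProbabilityMeasure_gammaLaw (a : ℝ) : IsProbabilityMeasure (gammaLaw a) := by
  unfold gammaLaw
  split_ifs with h
  · exact isProbabilityMeasure_gammaMeasure h one_pos
  · infer_instance

lemma measurable_normalize {k : ℕ} :
    Measurable fun (g : Fin k → ℝ) (i : Fin k) => g i / ∑ j, g j :=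
  measurable_pi_iff.2 fun i => (measurable_pi_apply i).div
    (Finset.measurable_sum _ fun j _ => measurable_pi_apply j)

/-- Values on overlapping sets are sums of values on the cells they generate, whose joint law is
Dirichlet. The right-hand side involves only `α` and `Ψ`, which is what uniqueness needs. Empty
cells are harmless: their parameter is `0`. -/
lemma map_coe_eq_of_isDirichletProcess {X : Type*} [MeasurableSpace X] {D : Measure (Measure X)}
    {α : ℝ} {Ψ : Measure X} (hD : IsDirichletProcess D α Ψ) {J : Type*} [Fintype J]
    [DecidableEq J] {s : J → Set X} (hs : ∀ j, MeasurableSet (s j)) {k : ℕ}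
    (e : Fin k ≃ (J → Bool)) :
    D.map (fun ψ j => ψ (s j)) =
      (dirichletLaw fun i => α * (Ψ (partitionCell s (e i))).toReal).map fun y j =>
        ∑ c : J → Bool, if c j = true then ENNReal.ofReal (y (e.symm c)) else 0 := by
  have hcell := measurableSet_partitionCell hs
  have hR : Measurable fun (y : Fin k → ℝ) (j : J) =>
      ∑ c : J → Bool, if c j = true then ENNReal.ofReal (y (e.symm c)) else 0 := by
    refine measurable_pi_iff.2 fun j => Finset.measurable_sum _ fun c _ => ?_
    split_ifs
    · exact (measurable_pi_apply _).ennreal_ofReal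
    · exact measurable_const
  have hm : Measurable fun (ψ : Measure X) (i : Fin k) => (ψ (partitionCell s (e i))).toReal :=
    measurable_pi_iff.2 fun i => (Measure.measurable_coe (hcell _)).ennreal_toReal
  rw [← hD.partition k (fun i => partitionCell s (e i)) (fun i => hcell _)
    (fun i j hij => pairwise_disjoint_partitionCell (e.injective.ne hij)) ?_,
    Measure.map_map hR hm]
  · refine Measure.map_congr ?_
    filter_upwards [hD.law.ae_isProbabilityMeasure] with ψ hψ
    ext1 j
    rw [measure_eq_sum_partitionCell hs ψ j]
    refine Finset.sum_congr rfl fun c _ => ?_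
    simp only [Equiv.apply_symm_apply,
      ENNReal.ofReal_toReal (measure_ne_top ψ _)]
  · refine Set.eq_univ_of_forall fun x => ?_
    obtain ⟨c, hc⟩ := exists_mem_partitionCell (s := s) x
    exact Set.mem_iUnion.2 ⟨e.symm c, by simpa using hc⟩

/-- The law of a Dirichlet process is determined by its precision and its base measure. -/
lemma IsDirichletProcess.unique {X : Type*} [MeasurableSpace X] {D₁ D₂ : Measure (Measure X)}
    {α : ℝ} {Ψ : Measure X} (h₁ : IsDirichletProcess D₁ α Ψ) (h₂ : IsDirichletProcess D₂ α Ψ) :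
    D₁ = D₂ := by
  classical
  have := h₁.law.isProbabilityMeasure
  have := h₂.law.isProbabilityMeasure
  let e : Measure X → {s : Set X // MeasurableSet s} → ℝ≥0∞ := fun ψ s => ψ s
  have he : Measurable e := measurable_pi_iff.2 fun s => Measure.measurable_coe s.2
  have := Measure.isProbabilityMeasure_map (μ := D₁) he.aemeasurable
  have hfin : ∀ I : Finset {s : Set X // MeasurableSet s},
      (D₂.map e).map I.restrict = (D₁.map e).map I.restrict := by
    intro I
    have hs : ∀ j : I, MeasurableSet (j.1 : Set X) := fun j => j.1.2
    rw [Measure.map_map (Finset.measurable_restrict I) he,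
      Measure.map_map (Finset.measurable_restrict I) he]
    exact (map_coe_eq_of_isDirichletProcess h₂ hs (Fintype.equivFin _).symm).trans
      (map_coe_eq_of_isDirichletProcess h₁ hs (Fintype.equivFin _).symm).symm
  refine ext_of_map_coe ?_
  -- Both laws of the evaluation process have the same finite-dimensional marginals, and a
  -- projective limit of finite measures is unique.
  have hproj : IsProjectiveLimit (D₁.map e) fun I => (D₁.map e).map I.restrict := fun I => rfl
  have : ∀ I : Finset {s : Set X // MeasurableSet s},
      IsFiniteMeasure ((D₁.map e).map I.restrict) := fun I => inferInstance
  exact hproj.unique hfin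

/-- Maps preserving the base measure preserve the Dirichlet process. -/
lemma IsDirichletProcess.map_map_eq {X : Type*} [MeasurableSpace X] {D : Measure (Measure X)}
    {α : ℝ} {Ψ : Measure X} (hD : IsDirichletProcess D α Ψ) {g : X → X} (hg : Measurable g)
    (hΨ : Ψ.map g = Ψ) : D.map (Measure.map g) = D := by
  have := hD.law.isProbabilityMeasure
  have hmg : Measurable (Measure.map g : Measure X → Measure X) := Measure.measurable_map g hg
  refine IsDirichletProcess.unique (α := α) (Ψ := Ψ)
    ⟨⟨Measure.isProbabilityMeasure_map hmg.aemeasurable, ?_⟩, fun k B hB hdisj hun => ?_⟩ hD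
  · rw [ae_map_iff hmg.aemeasurable (measurableSet_isProbabilityMeasure X)]
    filter_upwards [hD.law.ae_isProbabilityMeasure] with ψ hψ
    exact Measure.isProbabilityMeasure_map hg.aemeasurable
  · have hm : Measurable fun (ψ : Measure X) (i : Fin k) => (ψ (B i)).toReal :=
      measurable_pi_iff.2 fun i => (Measure.measurable_coe (hB i)).ennreal_toReal
    -- The preimages form a partition with the same masses under `Ψ`, hence the same Dirichlet
    -- parameters.
    have h := hD.partition k (fun i => g ⁻¹' B i) (fun i => hg (hB i))
      (fun i j hij => (hdisj hij).preimage g)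
      (by rw [← Set.preimage_iUnion, hun, Set.preimage_univ])
    rw [Measure.map_map hm hmg]
    simp only [← Measure.map_apply hg (hB _), hΨ] at h
    exact h

lemma measurableSet_apply_eq_zero {k : ℕ} (i : Fin k) :
    MeasurableSet {y : Fin k → ℝ | y i = 0} :=
  measurable_pi_apply i (measurableSet_singleton 0)

lemma dirichletLaw_ae_eq_zero {k : ℕ} {a : Fin k → ℝ} {i : Fin k} (hi : a i = 0) :
    ∀ᵐ y ∂dirichletLaw a, y i = 0 := by
  rw [dirichletLaw, ae_map_iff measurable_normalize.aemeasurable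
    (measurableSet_apply_eq_zero i)]
  have h : ∀ᵐ t ∂gammaLaw (a i), t = 0 := by
    rw [hi, gammaLaw, if_neg (lt_irrefl _)]
    simp [ae_dirac_eq]
  have h2 : ∀ᵐ g ∂(Measure.pi fun i => gammaLaw (a i)), g i = 0 :=
    (Measure.tendsto_eval_ae_ae (μ := fun i => gammaLaw (a i)) (i := i)).eventually h
  filter_upwards [h2] with g hg
  rw [hg, zero_div]

/-- A Dirichlet process does not charge the null sets of its base measure. -/
lemma IsDirichletProcess.ae_measure_eq_zero {X : Type*} [MeasurableSpace X]
    {D : Measure (Measure X)} {α : ℝ} {Ψ : Measure X} (hD : IsDirichletProcess D α Ψ) {N : Set X}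
    (hN : MeasurableSet N) (hN0 : Ψ N = 0) : ∀ᵐ ψ ∂D, ψ N = 0 := by
  have hB : ∀ i, MeasurableSet ((![Nᶜ, N] : Fin 2 → Set X) i) := by
    intro i
    fin_cases i
    · exact hN.compl
    · exact hN
  have hm : Measurable fun (ψ : Measure X) (i : Fin 2) =>
      (ψ ((![Nᶜ, N] : Fin 2 → Set X) i)).toReal :=
    measurable_pi_iff.2 fun i => (Measure.measurable_coe (hB i)).ennreal_toReal
  -- In the partition into `Nᶜ` and `N` the second parameter is `0`, which makes that coordinate of
  -- the Dirichlet vector vanish.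
  have h := hD.partition 2 ![Nᶜ, N] hB ?_ ?_
  · have h0 := dirichletLaw_ae_eq_zero (k := 2) (i := 1)
      (a := fun i => α * (Ψ ((![Nᶜ, N] : Fin 2 → Set X) i)).toReal) (by simp [hN0])
    rw [← h, ae_map_iff hm.aemeasurable (measurableSet_apply_eq_zero _)] at h0
    filter_upwards [h0, hD.law.ae_isProbabilityMeasure] with ψ hψ hψ'
    have h1 : (ψ N).toReal = 0 := by simpa using hψ
    exact (ENNReal.toReal_eq_zero_iff _).1 h1 |>.resolve_right (measure_ne_top ψ N)
  · intro i j hij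
    fin_cases i <;> fin_cases j <;>
      simp [Function.onFun, disjoint_compl_left, disjoint_compl_right] at hij ⊢
  · rw [Set.eq_univ_iff_forall]
    intro x
    by_cases hx : x ∈ N
    · exact Set.mem_iUnion.2 ⟨1, hx⟩
    · exact Set.mem_iUnion.2 ⟨0, hx⟩

/-! ### Orthogonal invariance of the base measure -/

/-- The map `V ↦ A V A'` on square matrices. -/
def conjMatrix {p : ℕ} (A V : Mat p) : Mat p := A * V * A.transpose

lemma continuous_conjMatrix {p : ℕ} (A : Mat p) : Continuous (conjMatrix A) :=
  Continuous.matrix_mul (Continuous.matrix_mul continuous_const continuous_id) continuous_const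

lemma measurable_conjMatrix {p : ℕ} (A : Mat p) : Measurable (conjMatrix A) :=
  (continuous_conjMatrix A).measurable

lemma conjMatrix_transpose_conjMatrix {p : ℕ} {A : Mat p}
    (hA : A ∈ Matrix.orthogonalGroup (Fin p) ℝ) (V : Mat p) :
    conjMatrix A.transpose (conjMatrix A V) = V := by
  rw [conjMatrix, conjMatrix, Matrix.transpose_transpose, Matrix.mul_assoc, Matrix.mul_assoc,
    orthogonal_transpose_mul hA, Matrix.mul_one, ← Matrix.mul_assoc, orthogonal_transpose_mul hA,
    Matrix.one_mul]

lemma continuous_symmMatrix {p : ℕ} : Continuous (symmMatrix (p := p)) :=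
  continuous_pi fun _ => continuous_pi fun _ => continuous_apply _

lemma symmMatrix_of_transpose_eq {p : ℕ} {V : Mat p} (hV : V.transpose = V) :
    symmMatrix (fun q : UpperIndex p => V q.1.1 q.1.2) = V := by
  ext i j
  rcases le_total i j with h | h
  · simp [symmMatrix, h]
  · have := congrFun (congrFun hV i) j
    simpa [symmMatrix, h] using this

lemma transpose_symmMatrix {p : ℕ} (t : UpperIndex p → ℝ) :
    (symmMatrix t).transpose = symmMatrix t := by
  ext i j
  simp [symmMatrix, min_comm, max_comm]

lemma symmMatrix_apply {p : ℕ} (t : UpperIndex p → ℝ) (q : UpperIndex p) :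
    symmMatrix t q.1.1 q.1.2 = t q := by
  have := q.2
  simp [symmMatrix, this]

/-- The map `V ↦ A V A'` in the coordinates on and above the diagonal of a symmetric matrix. -/
def conjSymm {p : ℕ} (A : Mat p) : (UpperIndex p → ℝ) →ₗ[ℝ] (UpperIndex p → ℝ) where
  toFun t q := conjMatrix A (symmMatrix t) q.1.1 q.1.2
  map_add' s t := by
    have h : symmMatrix (s + t) = symmMatrix s + symmMatrix t := rfl
    ext q
    simp [conjMatrix, h, Matrix.mul_add, Matrix.add_mul]
  map_smul' c t := by
    have h : symmMatrix (c • t) = c • symmMatrix t := rfl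
    ext q
    simp [conjMatrix, h]

lemma symmMatrix_conjSymm {p : ℕ} (A : Mat p) (t : UpperIndex p → ℝ) :
    symmMatrix (conjSymm A t) = conjMatrix A (symmMatrix t) := by
  refine symmMatrix_of_transpose_eq (V := conjMatrix A (symmMatrix t)) ?_
  simp [conjMatrix, Matrix.transpose_mul, transpose_symmMatrix, Matrix.mul_assoc]

lemma symmMatrix_injective {p : ℕ} : Function.Injective (symmMatrix (p := p)) := by
  intro s t h
  ext q
  rw [← symmMatrix_apply s, h, symmMatrix_apply]

lemma conjSymm_transpose_comp {p : ℕ} {A : Mat p} (hA : A ∈ Matrix.orthogonalGroup (Fin p) ℝ) :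
    conjSymm A.transpose ∘ₗ conjSymm A = LinearMap.id := by
  refine LinearMap.ext fun t => symmMatrix_injective ?_
  rw [LinearMap.comp_apply, symmMatrix_conjSymm, symmMatrix_conjSymm,
    conjMatrix_transpose_conjMatrix hA, LinearMap.id_apply]

lemma det_conjSymm_ne_zero {p : ℕ} {A : Mat p} (hA : A ∈ Matrix.orthogonalGroup (Fin p) ℝ) :
    LinearMap.det (conjSymm A) ≠ 0 := by
  have h := congrArg LinearMap.det (conjSymm_transpose_comp hA)
  rw [LinearMap.det_comp, LinearMap.det_id] at h
  exact right_ne_zero_of_mul (h ▸ one_ne_zero)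

lemma trace_conjMatrix {p : ℕ} {A : Mat p} (hA : A ∈ Matrix.orthogonalGroup (Fin p) ℝ)
    (V : Mat p) : (conjMatrix A V * (conjMatrix A V).transpose).trace =
      (V * V.transpose).trace := by
  have h : conjMatrix A V * (conjMatrix A V).transpose = A * (V * V.transpose * A.transpose) := by
    simp only [conjMatrix, Matrix.transpose_mul, Matrix.transpose_transpose, Matrix.mul_assoc]
    rw [← Matrix.mul_assoc A.transpose A, orthogonal_transpose_mul hA, Matrix.one_mul]
  rw [h, Matrix.trace_mul_comm, Matrix.mul_assoc, orthogonal_transpose_mul hA, Matrix.mul_one]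

/-- Conjugation preserves the set where `tr(V V') ≤ 1`, which has positive finite volume, so the
linear map must preserve volume. This avoids computing the determinant. -/
lemma abs_det_conjSymm {p : ℕ} {A : Mat p} (hA : A ∈ Matrix.orthogonalGroup (Fin p) ℝ) :
    |LinearMap.det (conjSymm A)| = 1 := by
  let f : (UpperIndex p → ℝ) → ℝ := fun t => (symmMatrix t * (symmMatrix t).transpose).trace
  have hf : Continuous f := continuous_trace_mul_transpose.comp continuous_symmMatrix
  let B : Set (UpperIndex p → ℝ) := {t | f t ≤ 1}
  have hB : conjSymm A ⁻¹' B = B := by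
    ext t
    simp only [B, f, Set.mem_preimage, Set.mem_ofPred_eq, symmMatrix_conjSymm, trace_conjMatrix hA]
  have h0 : volume B ≠ 0 := by
    have hU : IsOpen {t | f t < 1} := isOpen_lt hf continuous_const
    refine fun h => hU.measure_ne_zero volume ⟨0, ?_⟩
      (measure_mono_null (fun t (ht : f t < 1) => show f t ≤ 1 from ht.le) h)
    have hz : symmMatrix (0 : UpperIndex p → ℝ) = 0 := rfl
    simp [f, hz]
  have htop : volume B ≠ ∞ := by
    refine ((Metric.isBounded_iff_subset_closedBall 0).2 ⟨1, fun t ht => ?_⟩).measure_lt_top.ne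
    rw [mem_closedBall_zero_iff, pi_norm_le_iff_of_nonneg zero_le_one]
    intro q
    rw [Real.norm_eq_abs, ← symmMatrix_apply t q]
    have h1 := (sq_entry_le_trace (symmMatrix t) q.1.1 q.1.2).trans ht
    exact abs_le_one_iff_mul_self_le_one.2 (by rwa [← sq])
  have h := Measure.addHaar_preimage_linearMap volume (det_conjSymm_ne_zero hA) B
  rw [hB] at h
  have h1 : ENNReal.ofReal |(LinearMap.det (conjSymm A))⁻¹| = 1 :=
    (ENNReal.mul_left_inj h0 htop).1 (by rw [one_mul]; exact h.symm)
  rw [ENNReal.ofReal_eq_one, abs_inv] at h1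
  exact inv_eq_one.1 h1

lemma symmetricLebesgue_map_conjMatrix {p : ℕ} {A : Mat p}
    (hA : A ∈ Matrix.orthogonalGroup (Fin p) ℝ) :
    (symmetricLebesgue p).map (conjMatrix A) = symmetricLebesgue p := by
  have hc : Measurable (conjSymm A) := (conjSymm A).continuous_of_finiteDimensional.measurable
  have h : (volume : Measure (UpperIndex p → ℝ)).map (conjSymm A) = volume := by
    rw [Measure.map_linearMap_addHaar_eq_smul_addHaar _ (det_conjSymm_ne_zero hA), abs_inv,
      abs_det_conjSymm hA]
    simp
  rw [symmetricLebesgue, Measure.map_map (measurable_conjMatrix A) continuous_symmMatrix.measurable]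
  conv_rhs => rw [← h, Measure.map_map continuous_symmMatrix.measurable hc]
  congr 1
  ext1 t
  exact (symmMatrix_conjSymm A t).symm

lemma one_sub_conjMatrix {p : ℕ} {A : Mat p} (hA : A ∈ Matrix.orthogonalGroup (Fin p) ℝ)
    (V : Mat p) : 1 - conjMatrix A V = conjMatrix A (1 - V) := by
  rw [conjMatrix, conjMatrix, Matrix.mul_sub, Matrix.sub_mul, Matrix.mul_one,
    orthogonal_mul_transpose hA]

lemma det_conjMatrix {p : ℕ} {A : Mat p} (hA : A ∈ Matrix.orthogonalGroup (Fin p) ℝ)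
    (V : Mat p) : (conjMatrix A V).det = V.det := by
  rw [conjMatrix, Matrix.det_mul, Matrix.det_mul, Matrix.det_transpose, mul_right_comm, ← sq,
    orthogonal_det_sq hA, one_mul]

lemma posDef_conjMatrix_iff {p : ℕ} {A : Mat p} (hA : A ∈ Matrix.orthogonalGroup (Fin p) ℝ)
    (V : Mat p) : (conjMatrix A V).PosDef ↔ V.PosDef := by
  rw [posDef_iff_posSemidef_det_ne_zero, posDef_iff_posSemidef_det_ne_zero, det_conjMatrix hA,
    conjMatrix, posSemidef_conj_iff (orthogonal_det_ne_zero hA)]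

lemma measurable_one_sub {p : ℕ} : Measurable fun V : Mat p => 1 - V :=
  (continuous_const.sub continuous_id).measurable

lemma measurableSet_posDefUnit (p : ℕ) : MeasurableSet (posDefUnit p) :=
  (measurableSet_posDef p).inter (measurable_one_sub (measurableSet_posDef p))

lemma measurable_betaWeight (p : ℕ) (ω₁ ω₂ : ℝ) : Measurable (betaWeight p ω₁ ω₂) :=
  ((measurable_matrix_det.pow_const _).mul
    ((measurable_matrix_det.comp measurable_one_sub).pow_const _)).ennreal_ofReal

/-- Since `1 - A V A' = A (1 - V) A'`, conjugation preserves both determinants in the weight and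
both positivity conditions. -/
lemma betaUnnormalized_map_conjMatrix {p : ℕ} (ω₁ ω₂ : ℝ) {A : Mat p}
    (hA : A ∈ Matrix.orthogonalGroup (Fin p) ℝ) :
    (betaUnnormalized p ω₁ ω₂).map (conjMatrix A) = betaUnnormalized p ω₁ ω₂ := by
  have hc := measurable_conjMatrix A
  have hpre : conjMatrix A ⁻¹' posDefUnit p = posDefUnit p := by
    ext V
    simp only [posDefUnit, Set.mem_preimage, Set.mem_ofPred_eq, one_sub_conjMatrix hA,
      posDef_conjMatrix_iff hA]
  have hw : ∀ V, betaWeight p ω₁ ω₂ (conjMatrix A V) = betaWeight p ω₁ ω₂ V := by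
    intro V
    simp only [betaWeight, one_sub_conjMatrix hA, det_conjMatrix hA]
  have hr : ((symmetricLebesgue p).restrict (posDefUnit p)).map (conjMatrix A) =
      (symmetricLebesgue p).restrict (posDefUnit p) := by
    have h := Measure.restrict_map (μ := symmetricLebesgue p) hc (measurableSet_posDefUnit p)
    rwa [symmetricLebesgue_map_conjMatrix hA, hpre, eq_comm] at h
  ext B hB
  rw [Measure.map_apply hc hB, betaUnnormalized, withDensity_apply _ (hc hB),
    withDensity_apply _ hB]
  conv_rhs => rw [← hr, setLIntegral_map hB (measurable_betaWeight p ω₁ ω₂) hc]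
  simp only [hw]

lemma multivariateBeta_map_conjMatrix {p : ℕ} (ω₁ ω₂ : ℝ) {A : Mat p}
    (hA : A ∈ Matrix.orthogonalGroup (Fin p) ℝ) :
    (multivariateBeta p ω₁ ω₂).map (conjMatrix A) = multivariateBeta p ω₁ ω₂ := by
  rw [multivariateBeta, Measure.map_smul, betaUnnormalized_map_conjMatrix ω₁ ω₂ hA]

lemma ae_multivariateBeta_posDef (p : ℕ) (ω₁ ω₂ : ℝ) :
    ∀ᵐ V ∂multivariateBeta p ω₁ ω₂, V.PosDef := by
  refine Measure.smul_absolutelyContinuous.ae_le ?_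
  refine (withDensity_absolutelyContinuous _ _).ae_le ?_
  filter_upwards [ae_restrict_mem (measurableSet_posDefUnit p)] with V hV
  exact hV.1

/-- The conditional law of `(U, V)` given `V`. -/
noncomputable def pairGivenSecond {p : ℕ} (V : Mat p) : Measure (Vec p × Mat p) :=
  (multivariateGaussian (0 : Vec p) (1 - V)).map fun u => (u, V)

lemma measurable_pairGivenSecond {p : ℕ} : Measurable (pairGivenSecond (p := p)) := by
  let κ : Kernel (Mat p) (Vec p) := ⟨fun V => multivariateGaussian 0 (1 - V),
    measurable_multivariateGaussian.comp (measurable_const.prodMk measurable_one_sub)⟩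
  have : IsMarkovKernel κ := ⟨fun V => (inferInstance :
    IsProbabilityMeasure (multivariateGaussian (0 : Vec p) (1 - V)))⟩
  refine Measure.measurable_of_measurable_coe _ fun B hB => ?_
  have h := Kernel.measurable_kernel_prodMk_left (κ := κ)
    (t := {w : Mat p × Vec p | (w.2, w.1) ∈ B}) (measurable_swap hB)
  have heq : (fun V : Mat p => pairGivenSecond V B) =
      fun V => κ V (Prod.mk V ⁻¹' {w | (w.2, w.1) ∈ B}) := by
    ext1 V
    rw [pairGivenSecond,
      Measure.map_apply (f := fun u => (u, V)) (measurable_id.prodMk measurable_const) hB]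
    rfl
  rw [heq]
  exact h

lemma baseMeasure_eq (p : ℕ) (ω₁ ω₂ : ℝ) :
    baseMeasure p ω₁ ω₂ = (multivariateBeta p ω₁ ω₂).bind pairGivenSecond := rfl

/-- The map `(u, V) ↦ (A u, A V A')`. -/
noncomputable def rotatePair {p : ℕ} (A : Mat p) (q : Vec p × Mat p) : Vec p × Mat p :=
  (affineMap 0 A q.1, conjMatrix A q.2)

lemma measurable_rotatePair {p : ℕ} (A : Mat p) : Measurable (rotatePair A) :=
  ((measurable_affineMap 0 A).comp measurable_fst).prodMk
    ((measurable_conjMatrix A).comp measurable_snd)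

/-- If `U ∼ N(0, 1 - V)`, then `A U` has covariance `A (1 - V) A' = 1 - A V A'`, the conditional
covariance belonging to `A V A'`. -/
lemma pairGivenSecond_map_rotatePair {p : ℕ} {A : Mat p}
    (hA : A ∈ Matrix.orthogonalGroup (Fin p) ℝ) (V : Mat p) :
    (pairGivenSecond V).map (rotatePair A) = pairGivenSecond (conjMatrix A V) := by
  have hm : ∀ V : Mat p, Measurable fun u : Vec p => (u, V) := fun V =>
    measurable_id.prodMk measurable_const
  have h : multivariateGaussian (0 : Vec p) (1 - conjMatrix A V) =
      (multivariateGaussian 0 (1 - V)).map (affineMap 0 A) := by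
    rw [multivariateGaussian_map_affineMap 0 (orthogonal_det_ne_zero hA), one_sub_conjMatrix hA]
    simp [affineMap, conjMatrix]
  rw [pairGivenSecond, pairGivenSecond, h, Measure.map_map (measurable_rotatePair A) (hm V),
    Measure.map_map (hm _) (measurable_affineMap 0 A)]
  rfl

lemma baseMeasure_map_rotatePair {p : ℕ} (ω₁ ω₂ : ℝ) {A : Mat p}
    (hA : A ∈ Matrix.orthogonalGroup (Fin p) ℝ) :
    (baseMeasure p ω₁ ω₂).map (rotatePair A) = baseMeasure p ω₁ ω₂ := by
  rw [baseMeasure_eq, map_bind _ measurable_pairGivenSecond (measurable_rotatePair A)]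
  simp only [pairGivenSecond_map_rotatePair hA]
  rw [← bind_map _ (measurable_conjMatrix A) measurable_pairGivenSecond,
    multivariateBeta_map_conjMatrix ω₁ ω₂ hA]

lemma measurableSet_snd_not_posDef (p : ℕ) :
    MeasurableSet {q : Vec p × Mat p | ¬ q.2.PosDef} :=
  measurable_snd (measurableSet_posDef p).compl

lemma baseMeasure_not_posDef (p : ℕ) (ω₁ ω₂ : ℝ) :
    baseMeasure p ω₁ ω₂ {q | ¬ q.2.PosDef} = 0 := by
  rw [baseMeasure_eq, Measure.bind_apply (measurableSet_snd_not_posDef p)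
    measurable_pairGivenSecond.aemeasurable]
  refine (lintegral_congr_ae ?_).trans lintegral_zero
  filter_upwards [ae_multivariateBeta_posDef p ω₁ ω₂] with V hV
  rw [pairGivenSecond,
    Measure.map_apply (f := fun u => (u, V)) (measurable_id.prodMk measurable_const)
      (measurableSet_snd_not_posDef p)]
  simp [hV]

/-! ### The Dirichlet process mixture -/

/-- The component `N(m + L u, L V L')` of a normal mixture. -/
noncomputable def mixtureComponent {p : ℕ} (m : Vec p) (L : Mat p) (q : Vec p × Mat p) :
    Measure (Vec p) :=
  multivariateGaussian (affineMap m L q.1) (L * q.2 * L.transpose)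

lemma measurable_mixtureComponent {p : ℕ} (m : Vec p) (L : Mat p) :
    Measurable (mixtureComponent m L) :=
  measurable_multivariateGaussian.comp (((measurable_affineMap m L).comp measurable_fst).prodMk
    ((measurable_conjMatrix L).comp measurable_snd))

lemma normalMixture_eq {p : ℕ} (m : Vec p) (L : Mat p) (ψ : Measure (Vec p × Mat p)) :
    normalMixture m L ψ = ψ.bind (mixtureComponent m L) := rfl

lemma measurable_normalMixture {p : ℕ} (m : Vec p) (L : Mat p) : Measurable (normalMixture m L) :=
  Measure.measurable_bind' (measurable_mixtureComponent m L)

lemma mixtureComponent_zero_one {p : ℕ} (q : Vec p × Mat p) :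
    mixtureComponent 0 1 q = multivariateGaussian q.1 q.2 := by
  simp [mixtureComponent]

/-- Taking images commutes with mixing, and each Gaussian component transforms correctly. This
identifies `F⋆` as the mixture with location `0` and scale `1`. -/
lemma normalMixture_eq_map {p : ℕ} (m : Vec p) {L : Mat p} (hL : L.det ≠ 0)
    (ψ : Measure (Vec p × Mat p)) :
    normalMixture m L ψ = locationScale m L (normalMixture 0 1 ψ) := by
  rw [locationScale, normalMixture_eq, normalMixture_eq,
    map_bind _ (measurable_mixtureComponent 0 1) (measurable_affineMap m L)]
  simp only [mixtureComponent_zero_one, multivariateGaussian_map_affineMap m hL]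
  rfl

lemma normalMixture_map_rotatePair {p : ℕ} (A : Mat p) (ψ : Measure (Vec p × Mat p)) :
    normalMixture 0 1 (ψ.map (rotatePair A)) = normalMixture 0 A ψ := by
  rw [normalMixture_eq, bind_map _ (measurable_rotatePair A) (measurable_mixtureComponent 0 1)]
  simp only [mixtureComponent_zero_one]
  rfl

lemma isProbabilityMeasure_normalMixture {p : ℕ} (m : Vec p) (L : Mat p)
    (ψ : Measure (Vec p × Mat p)) [IsProbabilityMeasure ψ] :
    IsProbabilityMeasure (normalMixture m L ψ) := by
  refine ⟨?_⟩
  rw [normalMixture_eq, Measure.bind_apply MeasurableSet.univ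
    (measurable_mixtureComponent m L).aemeasurable]
  simp [mixtureComponent]

lemma normalMixture_absolutelyContinuous {p : ℕ} {ψ : Measure (Vec p × Mat p)}
    (hψ : ψ {q | ¬ q.2.PosDef} = 0) : normalMixture 0 1 ψ ≪ volume := by
  refine Measure.AbsolutelyContinuous.mk fun B hB hB0 => ?_
  rw [normalMixture_eq, Measure.bind_apply hB (measurable_mixtureComponent 0 1).aemeasurable]
  refine (lintegral_congr_ae ?_).trans lintegral_zero
  have h : ∀ᵐ q ∂ψ, q.2.PosDef := hψ
  filter_upwards [h] with q hq
  rw [mixtureComponent_zero_one]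
  exact multivariateGaussian_absolutelyContinuous q.1 hq hB0

section DirichletProcessMixture

variable {p : ℕ} {α ω₁ ω₂ : ℝ} {D : Measure (Measure (Vec p × Mat p))}

lemma ae_normalMixture_absolutelyContinuous
    (hD : IsDirichletProcess D α (baseMeasure p ω₁ ω₂)) :
    ∀ᵐ F ∂D.map (normalMixture 0 1), IsProbabilityMeasure F ∧ F ≪ (volume : Measure (Vec p)) := by
  rw [ae_map_iff (measurable_normalMixture 0 1).aemeasurable
    (measurableSet_isProbabilityMeasure_absolutelyContinuous p)]
  filter_upwards [hD.law.ae_isProbabilityMeasure, hD.ae_measure_eq_zero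
    (measurableSet_snd_not_posDef p) (baseMeasure_not_posDef p ω₁ ω₂)] with ψ h1 h2
  exact ⟨isProbabilityMeasure_normalMixture 0 1 ψ, normalMixture_absolutelyContinuous h2⟩

lemma isLocationScaleFamily_dpmFamily (hD : IsDirichletProcess D α (baseMeasure p ω₁ ω₂)) :
    IsLocationScaleFamily (dpmFamily D) (D.map (normalMixture 0 1)) where
  law := by
    have := hD.law.isProbabilityMeasure
    exact ⟨Measure.isProbabilityMeasure_map (measurable_normalMixture 0 1).aemeasurable,
      (ae_normalMixture_absolutelyContinuous hD).mono fun _ hF => hF.1⟩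
  eq_map m L hL := by
    rw [dpmFamily, Measure.map_map (measurable_locationScale m L) (measurable_normalMixture 0 1)]
    congr 1
    ext1 ψ
    exact normalMixture_eq_map m (det_pos_of_mem_posTriangular hL).ne' ψ

lemma isAbsolutelyContinuousLaw_dpm (hD : IsDirichletProcess D α (baseMeasure p ω₁ ω₂)) :
    IsAbsolutelyContinuousLaw (D.map (normalMixture 0 1)) :=
  (ae_normalMixture_absolutelyContinuous hD).mono fun _ hF => hF.2

/-- Rotating the mixture amounts to rotating the mixing measure by `rotatePair`, under which the law
of the Dirichlet process is invariant. -/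
lemma isRotationInvariantLaw_dpm (hD : IsDirichletProcess D α (baseMeasure p ω₁ ω₂)) :
    IsRotationInvariantLaw (D.map (normalMixture 0 1)) := by
  intro A hA
  have hA' := transpose_mem_orthogonalGroup hA
  have hrot := measurable_rotatePair A.transpose
  have hinv := hD.map_map_eq hrot (baseMeasure_map_rotatePair ω₁ ω₂ hA')
  conv_rhs => rw [← hinv]
  rw [Measure.map_map (measurable_locationScale _ _) (measurable_normalMixture 0 1),
    Measure.map_map (measurable_normalMixture 0 1) (Measure.measurable_map _ hrot)]
  congr 1
  ext1 ψ
  simp only [Function.comp_apply]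
  rw [normalMixture_map_rotatePair, normalMixture_eq_map 0 (orthogonal_det_ne_zero hA')]

end DirichletProcessMixture

end AffineBayes

theorem mainTheorem5 (p n : ℕ) (hp : 1 ≤ p) (hn : p + 1 ≤ n) :
    -- the marginal likelihood of a Haar-mixed family
    (∀ (Fam : Vec p → Mat p → Measure (Measure (Vec p))) (Q : Measure (Measure (Vec p))),
      IsLocationScaleFamily Fam Q → IsAbsolutelyContinuousLaw Q → IsRotationInvariantLaw Q →
      -- it is a Lebesgue density of the predictive distribution
      predictive (haarMixture Fam) n =
          (volume : Measure (Fin n → Vec p)).withDensity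
            (marginalLikelihood (haarMixture Fam) n) ∧
      -- it transforms as claimed
      (∀ (a : Vec p) (S : Mat p), S.det ≠ 0 → ∀ x : Fin n → Vec p,
        marginalLikelihood (haarMixture Fam) n (fun i => affineMap a S (x i)) =
          ENNReal.ofReal (|S.det| ^ (-((n : ℤ) - 1))) *
            marginalLikelihood (haarMixture Fam) n x) ∧
      -- the Bayes factor of the normal model against the family is invariant
      (∀ (a : Vec p) (S : Mat p), S.det ≠ 0 → ∀ x : Fin n → Vec p,
        bayesFactor (normalFamily p) Fam n (fun i => affineMap a S (x i)) =
          bayesFactor (normalFamily p) Fam n x)) ∧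
    -- in particular, against the Dirichlet process mixture alternative
    (∀ (α ω₁ ω₂ : ℝ), 0 < α → ((p : ℝ) - 1) / 2 < ω₁ → ((p : ℝ) - 1) / 2 < ω₂ →
      ∀ D : Measure (Measure (Vec p × Mat p)), IsDirichletProcess D α (baseMeasure p ω₁ ω₂) →
      ∀ (a : Vec p) (S : Mat p), S.det ≠ 0 → ∀ x : Fin n → Vec p,
        bayesFactor (normalFamily p) (dpmFamily D) n (fun i => affineMap a S (x i)) =
          bayesFactor (normalFamily p) (dpmFamily D) n x) := by
  refine ⟨fun Fam Q h hac hrot => ⟨predictive_haarMixture h hac, ?_, ?_⟩, ?_⟩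
  · intro a S hS x
    exact marginalLikelihood_haarMixture_affineMap h hac hrot a hS x
  · intro a S hS x
    exact bayesFactor_affineMap h hac hrot a hS x
  · intro α ω₁ ω₂ _ _ _ D hD a S hS x
    exact bayesFactor_affineMap (isLocationScaleFamily_dpmFamily hD)
      (isAbsolutelyContinuousLaw_dpm hD) (isRotationInvariantLaw_dpm hD) a hS x
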